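/- Let $\rho$ be a finite relational vocabulary and let $k,\ell,q\in\mathbb N$. For a first-order $\rho$-formula $\varphi(\bar x;\bar y)$ with $|\bar x|=k$, $|\bar y|=\ell$, a $\rho$-structure $B$ with universe $U(B)$, and $\bar v\in U(B)^\ell$, let $[\![\varphi(\bar x;\bar v)]\!]^B:U(B)^k\to\{0,1\}$ be the function that maps $\bar u$ to $1$ if $B\models\varphi(\bar u;\bar v)$ and to $0$ otherwise. A training sequence is a finite sequence $T$ of pairs $(\bar u,c)\in U(B)^k\times\{0,1\}$, and $H:U(B)^k\to\{0,1\}$ is consistent with $T$ if $H(\bar u)=c$ for all $(\bar u,c)\in T$. For a finite structure $B$ write $n=|U(B)|$, and let $d$ be the maximum degree of the Gaifman graph of $B$ (distinct elements are adjacent if they occur together in a tuple of some relation); write $t=|T|$. An algorithm with local access to $B$ can store, copy and compare elements of $B$ that it knows from its input or from earlier queries, and can ask relation queries ("is $(u_1,\dots,u_m)\in R$?", at constant cost) and neighbourhood queries ("list all neighbours of $u$ in the Gaifman graph", at cost proportional to the size of the answer). Running times are measured with logarithmic cost: an element of $B$ has size $\lfloor\log_2 n\rfloor+1$. Then there are $q^*\in\mathbb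 N$, an algorithm $\mathfrak L$ (the learner) and an algorithm $\mathfrak E$ (the evaluator), both depending only on $\rho,k,\ell,q$ and the way formulas are coded as bit strings, such that for every finite $\rho$-structure $B$ and every training sequence $T$ over $B$, $\mathfrak L$ with input $T$ and local access to $B$ halts and either rejects or returns a formula $\varphi^*(\bar x;\bar y)$ together with a tuple $\bar v^*\in U(B)^\ell$, and the following hold. 1. If $\mathfrak L$ returns $(\varphi^*,\bar v^*)$, then $\varphi^*$ is a first-order formula of quantifier rank at most $q^*$, and $[\![\varphi^*(\bar x;\bar v^*)]\!]^B$ is consistent with $T$. 2. If there are a first-order formula $\varphi(\bar x;\bar y)$ of quantifier rank at most $q$ and a tuple $\bar v\in U(B)^\ell$ such that $[\![\varphi(\bar x;\bar v)]\!]^B$ is consistent with $T$, and if moreover $\ell=0$ or some element of $B$ occurs in $T$ (that is, $k\ge1$ and $t\ge1$), then $\mathfrak L$ does not reject. 3. $\mathfrak L$ runs in time polynomial in $\log n+d+t$: there are constants $C,c$, independent of $B$ and $T$, such that its running time is at most $C(\log n+d+t+1)^c$. 4. The returned hypotheses can be evaluated in time polynomial in $\log n+d$: if $\mathfrak L$ returns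 $(\varphi^*,\bar v^*)$, then for every $\bar u\in U(B)^k$ the algorithm $\mathfrak E$, given $\varphi^*,\bar v^*,\bar u$ and local access to $B$, computes $[\![\varphi^*(\bar x;\bar v^*)]\!]^B(\bar u)$ in time at most $C(\log n+d+1)^c$, with constants $C,c$ independent of $B$, $T$ and $\bar u$. -/

import Mathlib

open FirstOrder

universe u v w

/-! ## First-order logic: quantifier rank, Gaifman graph, definable hypotheses -/

/-- The quantifier rank (nesting depth of quantifiers). Mathlib's connectives `⊓`, `⊔`, `∼` and the
quantifier `∃'` are abbreviations through `falsum`, `imp` and `all`, and get the usual ranks. -/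
def quantifierRank {L : FirstOrder.Language.{u, v}} {α : Type} : {n : ℕ} → L.BoundedFormula α n → ℕ
  | _, .falsum => 0
  | _, .equal _ _ => 0
  | _, .rel _ _ => 0
  | _, .imp φ ψ => max (quantifierRank φ) (quantifierRank ψ)
  | _, .all φ => quantifierRank φ + 1

/-- The Gaifman graph of a relational structure: distinct elements are adjacent when they occur
together in a tuple of a relation. -/
def gaifmanGraph (L : FirstOrder.Language.{u, v}) (U : Type w) [L.Structure U] : SimpleGraph U where
  Adj a b := a ≠ b ∧ ∃ (m : ℕ) (R : L.Relations m) (xs : Fin m → U),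
    FirstOrder.Language.Structure.RelMap R xs ∧ a ∈ Set.range xs ∧ b ∈ Set.range xs
  symm := ⟨fun _ _ ⟨hne, m, R, xs, hR, ha, hb⟩ => ⟨hne.symm, m, R, xs, hR, hb, ha⟩⟩
  loopless := ⟨fun _ h => h.1 rfl⟩

/-- The maximum degree of the Gaifman graph of a finite structure. -/
noncomputable def maxDegree (L : FirstOrder.Language.{u, v}) (U : Type w) [L.Structure U] : ℕ :=
  ⨆ a : U, ((gaifmanGraph L U).neighborSet a).ncard

open Classical in
/-- The function `⟦φ(x̄ ; v̄)⟧ : U ^ k → {0, 1}` defined by a formula `φ(x̄ ; ȳ)` with instance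
variables `Fin k` and parameter variables `Fin ℓ`, and by the parameters `v̄`. -/
noncomputable def hypothesis {L : FirstOrder.Language.{u, v}} {U : Type w} [L.Structure U] {k ℓ : ℕ}
    (φ : L.Formula (Fin k ⊕ Fin ℓ)) (vs : Fin ℓ → U) (us : Fin k → U) : Bool :=
  decide (φ.Realize (Sum.elim us vs))

/-- A function `U ^ k → {0, 1}` is consistent with a training sequence. -/
def Consistent {U : Type w} {k : ℕ} (H : (Fin k → U) → Bool)
    (T : List ((Fin k → U) × Bool)) : Prop :=
  ∀ e ∈ T, H e.1 = e.2

/-! ## Programs with local access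

Programs work on finitely many stacks. A stack cell holds a bit or an element of the background
structure. Elements are opaque: a program can store, copy and compare them and use them in queries,
but it cannot create an element that was not in its input or in the answer to a query. -/

/-- Neighbourhood queries: a list of all neighbours of a given element. The order of the list is
not specified. (Relation queries are answered by the structure itself.) -/
structure LocalAccess (L : FirstOrder.Language.{u, v}) (U : Type w) [L.Structure U] where
  nbrs : U → List U
  nodup_nbrs : ∀ a, (nbrs a).Nodup
  mem_nbrs : ∀ a b, b ∈ nbrs a ↔ (gaifmanGraph L U).Adj a b

/-- The content of a single stack cell. -/
inductive Cell (U : Type w) : Type w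
  | bit (b : Bool)
  | elt (a : U)

/-- The stacks; the head of a list is the top of the stack. -/
abbrev Store (U : Type w) : Type w := ℕ → List (Cell U)

/-- The number of bits that represent an element: `O(log n)` in a structure of order `n`
(logarithmic cost measure). -/
noncomputable def eltSize (U : Type w) : ℕ := Nat.log 2 (Nat.card U) + 1

/-- The number of bits that represent the content of a cell. -/
noncomputable def Cell.size {U : Type w} : Cell U → ℕ
  | .bit _ => 1
  | .elt _ => eltSize U

/-- The size of the top cell of stack `x` (`0` if the stack is empty). -/
noncomputable def topSize {U : Type w} (s : Store U) (x : ℕ) : ℕ :=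
  match s x with
  | [] => 0
  | c :: _ => c.size

/-- Elementary instructions, acting on stacks given by their numbers. -/
inductive Instr : Type
  /-- push the bit `b` on stack `x` -/
  | push (x : ℕ) (b : Bool)
  /-- remove the top cell of stack `x` -/
  | pop (x : ℕ)
  /-- push a copy of the top cell of stack `x` on stack `y` -/
  | copy (x y : ℕ)
  /-- neighbourhood query: push all neighbours of the top element of stack `x` on stack `y` -/
  | nbr (x y : ℕ)

/-- Tests. -/
inductive Test (L : FirstOrder.Language.{u, v}) : Type v
  /-- is stack `x` nonempty? -/
  | nonempty (x : ℕ)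
  /-- is the top cell of stack `x` the bit `b`? -/
  | isBit (x : ℕ) (b : Bool)
  /-- do the stacks `x` and `y` have equal top cells? -/
  | same (x y : ℕ)
  /-- relation query: is the tuple of the top elements of the stacks `xs` in the relation `R`? -/
  | rel {m : ℕ} (R : L.Relations m) (xs : Fin m → ℕ)

/-- Programs. -/
inductive Program (L : FirstOrder.Language.{u, v}) : Type v
  | basic (i : Instr)
  | seq (p q : Program L)
  | ite (t : Test L) (p q : Program L)
  | loop (t : Test L) (p : Program L)

section Semantics

variable {L : FirstOrder.Language.{u, v}} {U : Type w} [L.Structure U]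

/-- The effect of an instruction. An instruction that is not applicable has no effect. -/
def Instr.apply (A : LocalAccess L U) : Instr → Store U → Store U
  | .push x b, s => Function.update s x (.bit b :: s x)
  | .pop x, s => Function.update s x (s x).tail
  | .copy x y, s =>
    match s x with
    | [] => s
    | c :: _ => Function.update s y (c :: s y)
  | .nbr x y, s =>
    match s x with
    | .elt a :: _ => Function.update s y ((A.nbrs a).map .elt ++ s y)
    | _ => s

/-- The cost of an instruction: the number of bits moved, plus one. A neighbourhood query costs
the size of the answer, that is, the degree times the size of an element, plus one. -/
noncomputable def Instr.cost (A : LocalAccess L U) : Instr → Store U → ℕ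
  | .push _ _, _ => 1
  | .pop x, s => 1 + topSize s x
  | .copy x _, s => 1 + topSize s x
  | .nbr x _, s =>
    match s x with
    | .elt a :: _ => 1 + (A.nbrs a).length * eltSize U
    | _ => 1

/-- When a test succeeds. -/
def Test.Holds : Test L → Store U → Prop
  | .nonempty x, s => s x ≠ []
  | .isBit x b, s => (s x).head? = some (.bit b)
  | .same x y, s => ∃ c, (s x).head? = some c ∧ (s y).head? = some c
  | .rel R xs, s => ∃ as, (∀ i, (s (xs i)).head? = some (.elt (as i))) ∧ FirstOrder.Language.Structure.RelMap R as

/-- The cost of a test: a comparison costs the number of bits compared, plus one; every other test,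
in particular a relation query, has constant cost. -/
noncomputable def Test.cost : Test L → Store U → ℕ
  | .same x y, s => 1 + topSize s x + topSize s y
  | _, _ => 1

/-- `Exec A p s s' c`: started with stacks `s`, the program `p` with local access `A` halts with
stacks `s'`, and its running time is `c`. -/
inductive Exec (A : LocalAccess L U) : Program L → Store U → Store U → ℕ → Prop
  | basic (i : Instr) (s : Store U) : Exec A (.basic i) s (i.apply A s) (i.cost A s)
  | seq {p q : Program L} {s s' s'' : Store U} {c c' : ℕ} :
      Exec A p s s' c → Exec A q s' s'' c' → Exec A (.seq p q) s s'' (c + c')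
  | ite_pos {t : Test L} {p q : Program L} {s s' : Store U} {c : ℕ} :
      t.Holds s → Exec A p s s' c → Exec A (.ite t p q) s s' (t.cost s + c)
  | ite_neg {t : Test L} {p q : Program L} {s s' : Store U} {c : ℕ} :
      ¬ t.Holds s → Exec A q s s' c → Exec A (.ite t p q) s s' (t.cost s + c)
  | loop_pos {t : Test L} {p : Program L} {s s' s'' : Store U} {c c' : ℕ} :
      t.Holds s → Exec A p s s' c → Exec A (.loop t p) s' s'' c' →
      Exec A (.loop t p) s s'' (t.cost s + c + c')
  | loop_neg {t : Test L} {p : Program L} {s : Store U} :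
      ¬ t.Holds s → Exec A (.loop t p) s s (t.cost s)

/-- On the given input (on stack `0`, all other stacks being empty), the program halts within
`bound` time units, and stack `0` then holds exactly the given output. -/
def Program.ComputesWithin (p : Program L) (A : LocalAccess L U) (input output : List (Cell U))
    (bound : ℕ) : Prop :=
  ∃ (s : Store U) (c : ℕ),
    Exec A p (Function.update (fun _ => []) 0 input) s c ∧ s 0 = output ∧ c ≤ bound

end Semantics

/-! ## Input and output conventions -/

/-- A tuple of elements, written on a stack. -/
def tupleCells {U : Type w} {m : ℕ} (a : Fin m → U) : List (Cell U) :=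
  List.ofFn fun i => .elt (a i)

/-- A training sequence, written on a stack: each example is the tuple followed by its label. -/
def trainingCells {U : Type w} {k : ℕ} (T : List ((Fin k → U) × Bool)) : List (Cell U) :=
  T.flatMap fun e => tupleCells e.1 ++ [.bit e.2]

/-- A pair of a formula and a parameter tuple, written on a stack. Formulas are written as bit
strings by means of `code`. -/
def hypothesisCells {L : FirstOrder.Language.{u, v}} {U : Type w} {k ℓ : ℕ}
    (code : L.Formula (Fin k ⊕ Fin ℓ) → List Bool)
    (h : L.Formula (Fin k ⊕ Fin ℓ) × (Fin ℓ → U)) : List (Cell U) :=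
  (code h.1).map .bit ++ tupleCells h.2

/-- The output of a learning algorithm, written on a stack: the bit `0` for "reject", or the bit
`1` followed by the formula and the parameters that are returned. -/
def outcomeCells {L : FirstOrder.Language.{u, v}} {U : Type w} {k ℓ : ℕ}
    (code : L.Formula (Fin k ⊕ Fin ℓ) → List Bool) :
    Option (L.Formula (Fin k ⊕ Fin ℓ) × (Fin ℓ → U)) → List (Cell U)
  | none => [.bit false]
  | some h => .bit true :: hypothesisCells code h

/-! A consistent hypothesis can be replaced by a local one, after which exhaustive search is cheap.
Local means two things. The formula is guarded: quantifiers range over neighbours of elements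
already named, so evaluation explores only a neighbourhood of fixed radius, in a number of steps
polynomial in d. The parameters lie within a distance n, depending only on k, ℓ, q, of the training
elements, which leaves a list of at most t · k · (d + 1)^n values for each. As the vocabulary is
finite, a fixed finite list of guarded formulas suffices (`candidates`), and the learner tries every
formula with every choice of parameters.

The replacement rests on a form of Gaifman's theorem inside one finite structure
(`LocEquiv.efEquiv`): tuples that agree for enough rounds of a game in which each new element is
adjacent to an old one also agree for q rounds of the ordinary game. The crucial step is
`LocEquiv.forth`, for an element z far from the first tuple whose local type seems to occur only
near the second tuple. A maximal scattered set of elements of this type is then small and can be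
copied close to the first tuple; together with z the copy would be larger than the maximum. Both
tuples live in the same structure, so one maximum serves both sides and no sentences have to be
compared.

For the parameters (`exists_near_subset`, `exists_consistent_candidate`), keep those that a chain of
short jumps links to the training elements. The others are far from all examples and from the kept
ones. If two examples agree locally together with the kept parameters, then the far parameters,
matched with themselves, can be added by `LocEquiv.union`, so the original formula gives both
examples the same value. Hence the labels respect local equivalence over the kept parameters, and a
guarded formula expresses them; the remaining parameter places are filled with arbitrary training
elements.

The rest verifies programs. Time is counted in steps of cost at most `unitCost`, which is polynomial
in log n + d; the step counts in `runs_learner` and `runs_evaluator` are polynomial because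
formulas, radius and number of nested loops are fixed. -/

/-! ## Distance in graphs -/

/-- `Near G r a b` says that the distance of `a` and `b` in the graph `G` is at most `r`. -/
def Near {V : Type w} (G : SimpleGraph V) : ℕ → V → V → Prop
  | 0, a, b => a = b
  | r + 1, a, b => ∃ c, Near G r a c ∧ (c = b ∨ G.Adj c b)

namespace Near

variable {V : Type w} {G : SimpleGraph V}

lemma refl (r : ℕ) (a : V) : Near G r a a := by
  induction r with
  | zero => rfl
  | succ r ih => exact ⟨a, ih, Or.inl rfl⟩

lemma mono {r r' : ℕ} (h : r ≤ r') {a b : V} (hab : Near G r a b) : Near G r' a b := by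
  induction h with
  | refl => exact hab
  | step _ ih => exact ⟨b, ih, Or.inl rfl⟩

lemma trans {r r' : ℕ} {a b c : V} (hab : Near G r a b) (hbc : Near G r' b c) :
    Near G (r + r') a c := by
  induction r' generalizing c with
  | zero => cases hbc; exact hab
  | succ r' ih =>
    obtain ⟨d, hd, h⟩ := hbc
    exact ⟨d, ih hd, h⟩

lemma of_adj {a b : V} (h : G.Adj a b) : Near G 1 a b := ⟨a, rfl, Or.inr h⟩

lemma symm {r : ℕ} {a b : V} (hab : Near G r a b) : Near G r b a := by
  induction r generalizing b with
  | zero => exact Eq.symm hab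
  | succ r ih =>
    obtain ⟨c, hc, h⟩ := hab
    have h1 : Near G 1 b c := by
      rcases h with h | h
      · exact ⟨b, rfl, Or.inl h.symm⟩
      · exact of_adj h.symm
    exact mono (by omega) (h1.trans (ih hc))

end Near

/-! ## Back-and-forth equivalences within a structure -/

section BackAndForth

variable (L : FirstOrder.Language.{u, v}) {U : Type w} [L.Structure U]

/-- A set of pairs that preserves equality and all relations, in both directions. -/
def PartialIso (S : Set (U × U)) : Prop :=
  (∀ p ∈ S, ∀ p' ∈ S, p.1 = p'.1 ↔ p.2 = p'.2) ∧
    ∀ (m : ℕ) (R : L.Relations m) (xs ys : Fin m → U), (∀ i, (xs i, ys i) ∈ S) →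
      (FirstOrder.Language.Structure.RelMap R xs ↔ FirstOrder.Language.Structure.RelMap R ys)

/-- The back-and-forth equivalence with `q` rounds, in which every new element has to be a
neighbour of an earlier one. -/
def LocEquiv : ℕ → Set (U × U) → Prop
  | 0, S => PartialIso L S
  | q + 1, S => PartialIso L S ∧ ∀ p ∈ S,
      (∀ z, (gaifmanGraph L U).Adj p.1 z →
        ∃ z', (gaifmanGraph L U).Adj p.2 z' ∧ LocEquiv q (insert (z, z') S)) ∧
      (∀ z', (gaifmanGraph L U).Adj p.2 z' →
        ∃ z, (gaifmanGraph L U).Adj p.1 z ∧ LocEquiv q (insert (z, z') S))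

/-- The Ehrenfeucht-Fraïssé equivalence with `q` rounds. -/
def EFEquiv : ℕ → Set (U × U) → Prop
  | 0, S => PartialIso L S
  | q + 1, S => PartialIso L S ∧ (∀ z, ∃ z', EFEquiv q (insert (z, z') S)) ∧
      (∀ z', ∃ z, EFEquiv q (insert (z, z') S))

variable {L}

namespace PartialIso

lemma mono {S S' : Set (U × U)} (h : S ⊆ S') (hS : PartialIso L S') : PartialIso L S :=
  ⟨fun p hp p' hp' => hS.1 p (h hp) p' (h hp'), fun m R xs ys hs => hS.2 m R xs ys fun i => h (hs i)⟩

lemma swap {S : Set (U × U)} (hS : PartialIso L S) : PartialIso L (Prod.swap ⁻¹' S) :=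
  ⟨fun _ hp _ hp' => (hS.1 _ hp _ hp').symm, fun m R xs ys hs => (hS.2 m R ys xs hs).symm⟩

lemma comp {S S' : Set (U × U)} (hS : PartialIso L S) (hS' : PartialIso L S') :
    PartialIso L {p | ∃ b, (p.1, b) ∈ S ∧ (b, p.2) ∈ S'} := by
  refine ⟨?_, fun m R xs ys hs => ?_⟩
  · rintro p ⟨b, h1, h2⟩ p' ⟨b', h1', h2'⟩
    exact (hS.1 _ h1 _ h1').trans (hS'.1 _ h2 _ h2')
  · choose b hb using hs
    exact (hS.2 m R xs b fun i => (hb i).1).trans (hS'.2 m R b ys fun i => (hb i).2)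

lemma diagonal {S : Set (U × U)} (h : ∀ p ∈ S, p.1 = p.2) : PartialIso L S := by
  refine ⟨fun p hp p' hp' => by rw [h p hp, h p' hp'], fun m R xs ys hs => ?_⟩
  have : xs = ys := funext fun i => h _ (hs i)
  rw [this]

/-- Entries of a related tuple are equal or adjacent. If the parts are at distance greater than 1 on
both sides, no related tuple meets both, and no equation holds across. -/
lemma union {S S' : Set (U × U)} (hS : PartialIso L S) (hS' : PartialIso L S')
    (h1 : ∀ p ∈ S, ∀ p' ∈ S', ¬ Near (gaifmanGraph L U) 1 p.1 p'.1)
    (h2 : ∀ p ∈ S, ∀ p' ∈ S', ¬ Near (gaifmanGraph L U) 1 p.2 p'.2) :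
    PartialIso L (S ∪ S') := by
  have key : ∀ (m : ℕ) (R : L.Relations m) (xs : Fin m → U) (i j : Fin m),
      FirstOrder.Language.Structure.RelMap R xs → Near (gaifmanGraph L U) 1 (xs i) (xs j) := by
    intro m R xs i j h
    by_cases hij : xs i = xs j
    · rw [hij]; exact Near.refl _ _
    · exact Near.of_adj ⟨hij, m, R, xs, h, ⟨i, rfl⟩, ⟨j, rfl⟩⟩
  have ne1 : ∀ p ∈ S, ∀ p' ∈ S', p.1 ≠ p'.1 := fun p hp p' hp' h =>
    h1 p hp p' hp' (h ▸ Near.refl _ _)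
  have ne2 : ∀ p ∈ S, ∀ p' ∈ S', p.2 ≠ p'.2 := fun p hp p' hp' h =>
    h2 p hp p' hp' (h ▸ Near.refl _ _)
  refine ⟨?_, fun m R xs ys hs => ?_⟩
  · rintro p (hp | hp) p' (hp' | hp')
    · exact hS.1 p hp p' hp'
    · exact iff_of_false (ne1 p hp p' hp') (ne2 p hp p' hp')
    · exact iff_of_false (ne1 p' hp' p hp).symm (ne2 p' hp' p hp).symm
    · exact hS'.1 p hp p' hp'
  · by_cases hall : ∀ i, (xs i, ys i) ∈ S
    · exact hS.2 m R xs ys hall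
    by_cases hall' : ∀ i, (xs i, ys i) ∈ S'
    · exact hS'.2 m R xs ys hall'
    push Not at hall hall'
    obtain ⟨i, hi⟩ := hall
    obtain ⟨j, hj⟩ := hall'
    have hi' := (hs i).resolve_left hi
    have hj' := (hs j).resolve_right hj
    exact iff_of_false (fun h => h1 _ hj' _ hi' (key m R xs j i h))
      (fun h => h2 _ hj' _ hi' (key m R ys j i h))

end PartialIso

namespace LocEquiv

lemma partialIso {q : ℕ} {S : Set (U × U)} (h : LocEquiv L q S) : PartialIso L S := by
  cases q with
  | zero => exact h
  | succ q => exact h.1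

lemma mono {q : ℕ} {S S' : Set (U × U)} (h : S ⊆ S') (hS : LocEquiv L q S') :
    LocEquiv L q S := by
  induction q generalizing S S' with
  | zero => exact PartialIso.mono h hS
  | succ q ih =>
    refine ⟨hS.1.mono h, fun p hp => ⟨fun z hz => ?_, fun z' hz' => ?_⟩⟩
    · obtain ⟨z', h1, h2⟩ := (hS.2 p (h hp)).1 z hz
      exact ⟨z', h1, ih (Set.insert_subset_insert h) h2⟩
    · obtain ⟨z, h1, h2⟩ := (hS.2 p (h hp)).2 z' hz'
      exact ⟨z, h1, ih (Set.insert_subset_insert h) h2⟩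

lemma of_succ {q : ℕ} {S : Set (U × U)} (hS : LocEquiv L (q + 1) S) : LocEquiv L q S := by
  induction q generalizing S with
  | zero => exact hS.1
  | succ q ih =>
    refine ⟨hS.1, fun p hp => ⟨fun z hz => ?_, fun z' hz' => ?_⟩⟩
    · obtain ⟨z', h1, h2⟩ := (hS.2 p hp).1 z hz
      exact ⟨z', h1, ih h2⟩
    · obtain ⟨z, h1, h2⟩ := (hS.2 p hp).2 z' hz'
      exact ⟨z, h1, ih h2⟩

lemma of_le {q q' : ℕ} (h : q ≤ q') {S : Set (U × U)} (hS : LocEquiv L q' S) :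
    LocEquiv L q S := by
  induction h with
  | refl => exact hS
  | step _ ih => exact ih hS.of_succ

lemma swap {q : ℕ} {S : Set (U × U)} (hS : LocEquiv L q S) :
    LocEquiv L q (Prod.swap ⁻¹' S) := by
  induction q generalizing S with
  | zero => exact PartialIso.swap hS
  | succ q ih =>
    have e : ∀ z z' : U, insert (z, z') (Prod.swap ⁻¹' S) = Prod.swap ⁻¹' (insert (z', z) S) := by
      intro z z'
      ext ⟨a, b⟩
      simp [and_comm]
    refine ⟨PartialIso.swap hS.1, fun p hp => ⟨fun z hz => ?_, fun z' hz' => ?_⟩⟩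
    · obtain ⟨z', h1, h2⟩ := (hS.2 _ hp).2 z hz
      exact ⟨z', h1, e z z' ▸ ih h2⟩
    · obtain ⟨z, h1, h2⟩ := (hS.2 _ hp).1 z' hz'
      exact ⟨z, h1, e z z' ▸ ih h2⟩

lemma comp {q : ℕ} {S S' : Set (U × U)} (hS : LocEquiv L q S) (hS' : LocEquiv L q S') :
    LocEquiv L q {p | ∃ b, (p.1, b) ∈ S ∧ (b, p.2) ∈ S'} := by
  induction q generalizing S S' with
  | zero => exact PartialIso.comp hS hS'
  | succ q ih =>
    have e : ∀ z b z' : U, insert (z, z') {p | ∃ b, (p.1, b) ∈ S ∧ (b, p.2) ∈ S'} ⊆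
        {p | ∃ c, (p.1, c) ∈ insert (z, b) S ∧ (c, p.2) ∈ insert (b, z') S'} := by
      rintro z b z' p (rfl | ⟨c, h1, h2⟩)
      · exact ⟨b, Or.inl rfl, Or.inl rfl⟩
      · exact ⟨c, Or.inr h1, Or.inr h2⟩
    refine ⟨PartialIso.comp hS.1 hS'.1, ?_⟩
    rintro p ⟨b, hb, hb'⟩
    refine ⟨fun z hz => ?_, fun z' hz' => ?_⟩
    · obtain ⟨y, h1, h2⟩ := (hS.2 _ hb).1 z hz
      obtain ⟨z', h1', h2'⟩ := (hS'.2 _ hb').1 y h1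
      exact ⟨z', h1', (ih h2 h2').mono (e z y z')⟩
    · obtain ⟨y, h1, h2⟩ := (hS'.2 _ hb').2 z' hz'
      obtain ⟨z, h1', h2'⟩ := (hS.2 _ hb).2 y h1
      exact ⟨z, h1', (ih h2' h2).mono (e z y z')⟩

lemma pair_trans {q : ℕ} {a b c : U} (h : LocEquiv L q {(a, b)}) (h' : LocEquiv L q {(b, c)}) :
    LocEquiv L q {(a, c)} :=
  (h.comp h').mono (by rintro p rfl; exact ⟨b, rfl, rfl⟩)

lemma diagonal {q : ℕ} {S : Set (U × U)} (h : ∀ p ∈ S, p.1 = p.2) : LocEquiv L q S := by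
  induction q generalizing S with
  | zero => exact PartialIso.diagonal h
  | succ q ih =>
    have e : ∀ z : U, ∀ p ∈ insert (z, z) S, p.1 = p.2 := by
      rintro z p (rfl | hp)
      · rfl
      · exact h p hp
    refine ⟨PartialIso.diagonal h, fun p hp => ⟨fun z hz => ?_, fun z hz => ?_⟩⟩
    · exact ⟨z, h p hp ▸ hz, ih (e z)⟩
    · exact ⟨z, h p hp ▸ hz, ih (e z)⟩

/-- Local equivalences between parts that are far from each other can be put together. -/
lemma union {q : ℕ} {S S' : Set (U × U)} (hS : LocEquiv L q S) (hS' : LocEquiv L q S')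
    (h1 : ∀ p ∈ S, ∀ p' ∈ S', ¬ Near (gaifmanGraph L U) (q + 1) p.1 p'.1)
    (h2 : ∀ p ∈ S, ∀ p' ∈ S', ¬ Near (gaifmanGraph L U) (q + 1) p.2 p'.2) :
    LocEquiv L q (S ∪ S') := by
  induction q generalizing S S' with
  | zero => exact PartialIso.union hS hS' h1 h2
  | succ q ih =>
    -- A round moves one edge away from one part, and the separation required drops by one with the
    -- number of rounds: more than q + 2 before, more than q + 1 after.
    have low : ∀ {a b : U}, ¬ Near (gaifmanGraph L U) (q + 1 + 1) a b →
        ¬ Near (gaifmanGraph L U) (q + 1) a b := fun h h' => h (h'.mono (by omega))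
    have left : ∀ {a b c : U}, (gaifmanGraph L U).Adj a c →
        ¬ Near (gaifmanGraph L U) (q + 1 + 1) a b → ¬ Near (gaifmanGraph L U) (q + 1) c b :=
      fun hac h h' => h (((Near.of_adj hac).trans h').mono (by omega))
    have right : ∀ {a b c : U}, (gaifmanGraph L U).Adj b c →
        ¬ Near (gaifmanGraph L U) (q + 1 + 1) a b → ¬ Near (gaifmanGraph L U) (q + 1) a c :=
      fun hac h h' => h (h'.trans (Near.of_adj hac.symm))
    have extend : ∀ p ∈ S, ∀ z z', (gaifmanGraph L U).Adj p.1 z → (gaifmanGraph L U).Adj p.2 z' →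
        LocEquiv L q (insert (z, z') S) → LocEquiv L q (insert (z, z') (S ∪ S')) := by
      intro p hp z z' hz hz' h
      rw [← Set.insert_union]
      refine ih h hS'.of_succ ?_ ?_
      · rintro p1 (rfl | hp1) p' hp'
        · exact left hz (h1 p hp p' hp')
        · exact low (h1 p1 hp1 p' hp')
      · rintro p1 (rfl | hp1) p' hp'
        · exact left hz' (h2 p hp p' hp')
        · exact low (h2 p1 hp1 p' hp')
    have extend' : ∀ p ∈ S', ∀ z z', (gaifmanGraph L U).Adj p.1 z →
        (gaifmanGraph L U).Adj p.2 z' →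
        LocEquiv L q (insert (z, z') S') → LocEquiv L q (insert (z, z') (S ∪ S')) := by
      intro p hp z z' hz hz' h
      rw [← Set.union_insert]
      refine ih hS.of_succ h ?_ ?_
      · rintro p' hp' p1 (rfl | hp1)
        · exact right hz (h1 p' hp' p hp)
        · exact low (h1 p' hp' p1 hp1)
      · rintro p' hp' p1 (rfl | hp1)
        · exact right hz' (h2 p' hp' p hp)
        · exact low (h2 p' hp' p1 hp1)
    refine ⟨PartialIso.union hS.1 hS'.1
      (fun p hp p' hp' h => h1 p hp p' hp' (h.mono (by omega)))
      (fun p hp p' hp' h => h2 p hp p' hp' (h.mono (by omega))), ?_⟩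
    rintro p (hp | hp)
    · refine ⟨fun z hz => ?_, fun z' hz' => ?_⟩
      · obtain ⟨z', hz', h⟩ := (hS.2 p hp).1 z hz
        exact ⟨z', hz', extend p hp z z' hz hz' h⟩
      · obtain ⟨z, hz, h⟩ := (hS.2 p hp).2 z' hz'
        exact ⟨z, hz, extend p hp z z' hz hz' h⟩
    · refine ⟨fun z hz => ?_, fun z' hz' => ?_⟩
      · obtain ⟨z', hz', h⟩ := (hS'.2 p hp).1 z hz
        exact ⟨z', hz', extend' p hp z z' hz hz' h⟩
      · obtain ⟨z, hz, h⟩ := (hS'.2 p hp).2 z' hz'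
        exact ⟨z, hz, extend' p hp z z' hz hz' h⟩

/-- One round is spent on each edge of a path to `z`; the pairs on the way are dropped by `mono`. -/
lemma walk {n j : ℕ} {S : Set (U × U)} (hS : LocEquiv L (n + j) S) {p : U × U} (hp : p ∈ S)
    {z : U} (hz : Near (gaifmanGraph L U) n p.1 z) :
    ∃ z', Near (gaifmanGraph L U) n p.2 z' ∧ LocEquiv L j (insert (z, z') S) := by
  induction n generalizing z j with
  | zero =>
    cases hz
    exact ⟨p.2, rfl, by rw [Set.insert_eq_of_mem hp]; exact hS.of_le (by omega)⟩
  | succ n ih =>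
    obtain ⟨c, hc, h⟩ := hz
    obtain ⟨c', hc', h'⟩ := ih (j := j + 1) (hS.of_le (by omega)) hc
    rcases h with rfl | h
    · exact ⟨c', ⟨c', hc', Or.inl rfl⟩, h'.of_succ⟩
    · obtain ⟨z', hz', h2⟩ := (h'.2 (c, c') (Set.mem_insert _ _)).1 z h
      exact ⟨z', ⟨c', hc', Or.inr hz'⟩,
        h2.mono (Set.insert_subset_insert (Set.subset_insert _ _))⟩

/-- Copy a path from `p.1` to `p'.1`. The copy ends in `p'.2`, since a partial isomorphism respects
equality. -/
lemma near {n : ℕ} {S : Set (U × U)} (hS : LocEquiv L n S) {p p' : U × U} (hp : p ∈ S)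
    (hp' : p' ∈ S) (h : Near (gaifmanGraph L U) n p.1 p'.1) :
    Near (gaifmanGraph L U) n p.2 p'.2 := by
  obtain ⟨z', hz', h'⟩ := hS.walk (j := 0) hp h
  have := (h'.partialIso.1 _ (Set.mem_insert _ _) p' (Set.mem_insert_of_mem _ hp')).1 rfl
  exact this ▸ hz'

/-- The elements of `Y` are copied one after the other, each by a walk of length `r` from `S`. All
copies stay in a single equivalence, so their types and mutual distances remain comparable with the
originals. -/
lemma transfer {r j : ℕ} {S : Set (U × U)} (Y : Finset U) (hS : LocEquiv L (Y.card * r + j) S)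
    (hY : ∀ y ∈ Y, ∃ p ∈ S, Near (gaifmanGraph L U) r p.1 y) :
    ∃ f : U → U, LocEquiv L j (S ∪ {p | p.1 ∈ Y ∧ p.2 = f p.1}) ∧
      ∀ y ∈ Y, ∃ p ∈ S, Near (gaifmanGraph L U) r p.2 (f y) := by
  classical
  induction Y using Finset.induction_on generalizing j with
  | empty => exact ⟨id, (hS.of_le (by simp)).mono (by simp), by simp⟩
  | insert y Y hy ih =>
    rw [Finset.card_insert_of_notMem hy] at hS
    obtain ⟨f, hf, hf'⟩ := ih (j := r + j) (hS.of_le (by ring_nf; rfl))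
      fun y' hy' => hY y' (Finset.mem_insert_of_mem hy')
    obtain ⟨p, hp, hpy⟩ := hY y (Finset.mem_insert_self _ _)
    obtain ⟨z', hz', h⟩ := hf.walk (Or.inl hp) hpy
    have ne : ∀ y' ∈ Y, y' ≠ y := fun y' hy' h => hy (h ▸ hy')
    refine ⟨Function.update f y z', h.mono ?_, ?_⟩
    · rintro ⟨a, b⟩ (hab | ⟨ha, hb⟩)
      · exact Or.inr (Or.inl hab)
      · simp only [Finset.mem_insert] at ha hb
        rcases ha with rfl | ha
        · left; simp [hb]
        · right; right; exact ⟨ha, by simpa [ne a ha] using hb⟩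
    · intro y' hy'
      rcases Finset.mem_insert.1 hy' with rfl | hy'
      · exact ⟨p, hp, by simpa using hz'⟩
      · simpa [ne y' hy'] using hf' y' hy'

end LocEquiv

namespace EFEquiv

lemma swap {q : ℕ} {S : Set (U × U)} (hS : EFEquiv L q S) :
    EFEquiv L q (Prod.swap ⁻¹' S) := by
  induction q generalizing S with
  | zero => exact PartialIso.swap hS
  | succ q ih =>
    have e : ∀ z z' : U, insert (z, z') (Prod.swap ⁻¹' S) = Prod.swap ⁻¹' (insert (z', z) S) := by
      intro z z'
      ext ⟨a, b⟩
      simp [and_comm]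
    refine ⟨PartialIso.swap hS.1, fun z => ?_, fun z' => ?_⟩
    · obtain ⟨z', h2⟩ := hS.2.2 z
      exact ⟨z', e z z' ▸ ih h2⟩
    · obtain ⟨z, h2⟩ := hS.2.1 z'
      exact ⟨z, e z z' ▸ ih h2⟩

lemma partialIso {q : ℕ} {S : Set (U × U)} (h : EFEquiv L q S) : PartialIso L S := by
  cases q with
  | zero => exact h
  | succ q => exact h.1

end EFEquiv

/-- The forth property for local equivalence: every element has a counterpart, not only those near
the elements that have been chosen already. -/
lemma LocEquiv.forth [Finite U] {Q m : ℕ} {S : Set (U × U)} (hfin : S.Finite) (hm : S.ncard ≤ m)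
    (hS : LocEquiv L (m * (Q + 1) + Q + 3 * (Q + 1)) S) (z : U) :
    ∃ z', LocEquiv L Q (insert (z, z') S) := by
  classical
  -- The threshold is the sum of Q + 1, the distance of a copied element from `S`, and 2 * (Q + 1),
  -- the scattering distance used below.
  by_cases hnear : ∃ p ∈ S, Near (gaifmanGraph L U) (3 * (Q + 1)) p.1 z
  · obtain ⟨p, hp, hz⟩ := hnear
    obtain ⟨z', -, h⟩ := (hS.of_le (q := 3 * (Q + 1) + Q) (by omega)).walk hp hz
    exact ⟨z', h⟩
  push Not at hnear
  by_cases hfar : ∃ x, LocEquiv L Q {(z, x)} ∧ ∀ p ∈ S, ¬ Near (gaifmanGraph L U) (Q + 1) p.2 x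
  · obtain ⟨x, hx, hx'⟩ := hfar
    refine ⟨x, ?_⟩
    rw [← Set.union_singleton]
    refine LocEquiv.union (hS.of_le (by omega)) hx ?_ ?_
    · rintro p hp _ rfl h
      exact hnear p hp (h.mono (by omega))
    · rintro p hp _ rfl h
      exact hx' p hp h
  push Not at hfar
  exfalso
  -- Now every element of the local type of `z` is within Q + 1 of a second component. `P` collects
  -- the scattered sets of elements of this type.
  let P : Set (Finset U) := {Y | (∀ y ∈ Y, LocEquiv L Q {(z, y)}) ∧
    ∀ y ∈ Y, ∀ y' ∈ Y, y ≠ y' → ¬ Near (gaifmanGraph L U) (2 * (Q + 1)) y y'}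
  obtain ⟨Y, hY, hmax⟩ := Set.exists_max_image P Finset.card (Set.toFinite P) ⟨∅, by simp [P]⟩
  choose! g hg hg' using fun y hy => hfar y (hY.1 y hy)
  -- Two members of `Y` close to the same second component would be within 2 * (Q + 1) of each
  -- other, so `g` is injective on `Y`.
  have hcard : Y.card ≤ m := by
    refine le_trans ?_ hm
    rw [← Set.ncard_coe_finset]
    refine Set.ncard_le_ncard_of_injOn g hg ?_ hfin
    intro y hy y' hy' hyy
    by_contra hne
    refine hY.2 y hy y' hy' hne ?_
    exact ((hg' y hy).symm.trans (hyy ▸ hg' y' hy')).mono (by omega)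
  have hle := Nat.mul_le_mul_right (Q + 1) hcard
  -- Copy `Y` to the side of the first components. The Q + 2 * (Q + 1) rounds that remain suffice to
  -- preserve both Q-round types and distances up to 2 * (Q + 1).
  obtain ⟨f, hf, hf'⟩ := (hS.swap.of_le (q := Y.card * (Q + 1) + (Q + 2 * (Q + 1)))
    (by omega)).transfer (r := Q + 1) Y fun y hy => ⟨(g y).swap, hg y hy, hg' y hy⟩
  have hmem : ∀ y ∈ Y, (y, f y) ∈ Prod.swap ⁻¹' S ∪ {p : U × U | p.1 ∈ Y ∧ p.2 = f p.1} :=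
    fun y hy => Or.inr ⟨hy, rfl⟩
  have hsep : ∀ y ∈ Y, ∀ y' ∈ Y, y ≠ y' →
      ¬ Near (gaifmanGraph L U) (2 * (Q + 1)) (f y) (f y') := by
    intro y hy y' hy' hne h
    exact hY.2 y hy y' hy' hne
      ((hf.of_le (by omega)).swap.near (p := (f y, y)) (p' := (f y', y')) (hmem y hy) (hmem y' hy') h)
  -- Otherwise `z` together with the copy of `Y` is a scattered set of the same type, larger than
  -- the maximum.
  have hclose : ∃ y ∈ Y, Near (gaifmanGraph L U) (2 * (Q + 1)) (f y) z := by
    by_contra hno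
    push Not at hno
    have hzn : z ∉ Y.image f := by
      intro h
      obtain ⟨y, hy, rfl⟩ := Finset.mem_image.1 h
      exact hno y hy (Near.refl _ _)
    have hP : insert z (Y.image f) ∈ P := by
      refine ⟨fun x hx => ?_, fun x hx x' hx' hne => ?_⟩
      · rcases Finset.mem_insert.1 hx with rfl | hx
        · exact LocEquiv.diagonal (by simp)
        · obtain ⟨y, hy, rfl⟩ := Finset.mem_image.1 hx
          exact (hY.1 y hy).pair_trans
            ((hf.of_le (by omega)).mono (by rintro _ rfl; exact hmem y hy))
      · rcases Finset.mem_insert.1 hx with rfl | hx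
        · rcases Finset.mem_insert.1 hx' with rfl | hx'
          · exact absurd rfl hne
          · obtain ⟨y, hy, rfl⟩ := Finset.mem_image.1 hx'
            exact fun h => hno y hy h.symm
        · obtain ⟨y, hy, rfl⟩ := Finset.mem_image.1 hx
          rcases Finset.mem_insert.1 hx' with rfl | hx'
          · exact hno y hy
          · obtain ⟨y', hy', rfl⟩ := Finset.mem_image.1 hx'
            exact hsep y hy y' hy' fun h => hne (h ▸ rfl)
    have h := hmax _ hP
    rw [Finset.card_insert_of_notMem hzn, Finset.card_image_of_injOn] at h
    · omega
    · intro y hy y' hy' hyy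
      by_contra hne
      exact hsep y hy y' hy' hne (hyy ▸ Near.refl _ _)
  obtain ⟨y, hy, hyz⟩ := hclose
  obtain ⟨p, hp, hpy⟩ := hf' y hy
  exact hnear p.swap hp ((hpy.trans hyz).mono (by omega))

/-- The number of local rounds that determine `q` unrestricted rounds played on `m` pairs. -/
def localRank : ℕ → ℕ → ℕ
  | 0, _ => 0
  | q + 1, m => m * (localRank q (m + 1) + 1) + localRank q (m + 1) + 3 * (localRank q (m + 1) + 1)

/-- Gaifman locality within a single finite structure. -/
theorem LocEquiv.efEquiv [Finite U] {q m : ℕ} {S : Set (U × U)} (hfin : S.Finite)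
    (hm : S.ncard ≤ m) (hS : LocEquiv L (localRank q m) S) : EFEquiv L q S := by
  induction q generalizing m S with
  | zero => exact hS
  | succ q ih =>
    have step : ∀ S : Set (U × U), S.Finite → S.ncard ≤ m → LocEquiv L (localRank (q + 1) m) S →
        ∀ z, ∃ z', EFEquiv L q (insert (z, z') S) := by
      intro S hfin hm hS z
      obtain ⟨z', h⟩ := LocEquiv.forth hfin hm hS z
      exact ⟨z', ih (m := m + 1) (hfin.insert _) ((Set.ncard_insert_le _ _).trans (by omega)) h⟩
    -- The back direction is the forth direction for the swapped pairs.
    refine ⟨hS.partialIso, step S hfin hm hS, fun z' => ?_⟩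
    have hinj : Function.Injective (Prod.swap : U × U → U × U) := Prod.swap_injective
    obtain ⟨z, hz⟩ := step (Prod.swap ⁻¹' S) (hfin.preimage hinj.injOn)
      (by
        rw [Set.ncard_preimage_of_injective_subset_range hinj
          (by rw [Prod.swap_surjective.range_eq]; exact Set.subset_univ _)]
        exact hm) hS.swap z'
    refine ⟨z, ?_⟩
    have e : insert (z, z') S = Prod.swap ⁻¹' (insert (z', z) (Prod.swap ⁻¹' S)) := by
      ext ⟨a, b⟩
      simp [and_comm]
    rw [e]
    exact hz.swap

/-- Formulas of quantifier rank at most `q` do not distinguish tuples that are equivalent in the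
game with `q` rounds. -/
theorem EFEquiv.realize_iff [L.IsRelational] {α : Type} {n q : ℕ} (φ : L.BoundedFormula α n)
    (hφ : quantifierRank φ ≤ q) {S : Set (U × U)} (hS : EFEquiv L q S) {v v' : α → U}
    {xs xs' : Fin n → U} (hv : ∀ i, (v i, v' i) ∈ S) (hxs : ∀ i, (xs i, xs' i) ∈ S) :
    φ.Realize v xs ↔ φ.Realize v' xs' := by
  have term : ∀ {n : ℕ} {S : Set (U × U)} {xs xs' : Fin n → U} (t : L.Term (α ⊕ Fin n)),
      (∀ i, (v i, v' i) ∈ S) → (∀ i, (xs i, xs' i) ∈ S) →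
      (t.realize (Sum.elim v xs), t.realize (Sum.elim v' xs')) ∈ S := by
    intro n S xs xs' t hv hxs
    cases t with
    | var x => cases x with
      | inl i => exact hv i
      | inr i => exact hxs i
    | func f _ => exact isEmptyElim f
  induction φ generalizing q S with
  | falsum => rfl
  | equal t t' => exact hS.partialIso.1 _ (term t hv hxs) _ (term t' hv hxs)
  | rel R ts => exact hS.partialIso.2 _ R _ _ fun i => term (ts i) hv hxs
  | imp φ ψ ihφ ihψ =>
    exact imp_congr (ihφ ((le_max_left _ _).trans hφ) hS hv hxs)
      (ihψ ((le_max_right _ _).trans hφ) hS hv hxs)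
  | all φ ih =>
    obtain ⟨q, rfl⟩ : ∃ q', q = q' + 1 := ⟨q - 1, by simp only [quantifierRank] at hφ; omega⟩
    have ext : ∀ z z', ∀ i, (Fin.snoc (α := fun _ => U) xs z i,
        Fin.snoc (α := fun _ => U) xs' z' i) ∈ insert (z, z') S := by
      intro z z' i
      refine Fin.lastCases ?_ (fun i => ?_) i
      · simp
      · simpa using Or.inr (hxs i)
    have hφ' : quantifierRank φ ≤ q := by simp only [quantifierRank] at hφ; omega
    constructor
    · intro h z'
      obtain ⟨z, hz⟩ := hS.2.2 z'
      exact (ih hφ' hz (fun i => Or.inr (hv i)) (ext z z')).1 (h z)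
    · intro h z
      obtain ⟨z', hz⟩ := hS.2.1 z
      exact (ih hφ' hz (fun i => Or.inr (hv i)) (ext z z')).2 (h z')

end BackAndForth

/-! ## Guarded formulas -/

/-- Formulas with `m` free variables whose quantifiers range over the neighbours of an element that
is already the value of a variable. -/
inductive Guarded (L : FirstOrder.Language.{u, v}) : ℕ → Type v
  | falsum {m : ℕ} : Guarded L m
  | eq {m : ℕ} (i j : Fin m) : Guarded L m
  | rel {m n : ℕ} (R : L.Relations n) (xs : Fin n → Fin m) : Guarded L m
  | imp {m : ℕ} (φ ψ : Guarded L m) : Guarded L m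
  | ex {m : ℕ} (i : Fin m) (φ : Guarded L (m + 1)) : Guarded L m

namespace Guarded

variable {L : FirstOrder.Language.{u, v}} {U : Type w} [L.Structure U] {m : ℕ}

def Realize : {m : ℕ} → Guarded L m → (Fin m → U) → Prop
  | _, falsum, _ => False
  | _, eq i j, a => a i = a j
  | _, rel R xs, a => FirstOrder.Language.Structure.RelMap R fun i => a (xs i)
  | _, imp φ ψ, a => φ.Realize a → ψ.Realize a
  | _, ex i φ, a => ∃ z, (gaifmanGraph L U).Adj (a i) z ∧ φ.Realize (Fin.snoc (α := fun _ => U) a z)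

def not (φ : Guarded L m) : Guarded L m := φ.imp falsum

def and (φ ψ : Guarded L m) : Guarded L m := (φ.imp ψ.not).not

@[simp] lemma realize_not {φ : Guarded L m} {a : Fin m → U} : φ.not.Realize a ↔ ¬ φ.Realize a :=
  Iff.rfl

@[simp] lemma realize_and {φ ψ : Guarded L m} {a : Fin m → U} :
    (φ.and ψ).Realize a ↔ φ.Realize a ∧ ψ.Realize a := by
  change (¬ (φ.Realize a → ¬ ψ.Realize a)) ↔ _
  tauto

/-- The disjunction of a list of formulas. -/
def disj : List (Guarded L m) → Guarded L m
  | [] => falsum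
  | φ :: l => φ.not.imp (disj l)

lemma realize_disj {l : List (Guarded L m)} {a : Fin m → U} :
    (disj l).Realize a ↔ ∃ φ ∈ l, φ.Realize a := by
  induction l with
  | nil => simp [disj, Realize]
  | cons φ l ih =>
    simp only [disj, Realize, realize_not, ih, List.mem_cons, exists_eq_or_imp]
    tauto

/-- All conjunctions that contain each formula of a list or its negation. -/
def types : List (Guarded L m) → List (Guarded L m)
  | [] => [falsum.not]
  | φ :: l => (types l).flatMap fun χ => [φ.and χ, φ.not.and χ]

lemma exists_mem_types (l : List (Guarded L m)) (a : Fin m → U) :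
    ∃ χ ∈ types l, χ.Realize a := by
  induction l with
  | nil => exact ⟨falsum.not, by simp [types], id⟩
  | cons φ l ih =>
    obtain ⟨χ, hχ, h⟩ := ih
    by_cases hφ : φ.Realize a
    · exact ⟨φ.and χ, by simp only [types, List.mem_flatMap]; exact ⟨χ, hχ, by simp⟩, by simp [*]⟩
    · exact ⟨φ.not.and χ, by simp only [types, List.mem_flatMap]; exact ⟨χ, hχ, by simp⟩,
        by simp [*]⟩

lemma realize_iff_of_mem_types {l : List (Guarded L m)} {χ φ : Guarded L m} (hχ : χ ∈ types l)
    {a b : Fin m → U} (ha : χ.Realize a) (hb : χ.Realize b) (hφ : φ ∈ l) :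
    φ.Realize a ↔ φ.Realize b := by
  induction l generalizing χ with
  | nil => simp at hφ
  | cons ψ l ih =>
    simp only [types, List.mem_flatMap, List.mem_cons, List.not_mem_nil, or_false] at hχ
    obtain ⟨χ', hχ', rfl | rfl⟩ := hχ <;> rw [realize_and] at ha hb <;>
      rcases List.mem_cons.1 hφ with rfl | hφ
    · exact iff_of_true ha.1 hb.1
    · exact ih hχ' ha.2 hb.2 hφ
    · exact iff_of_false ha.1 hb.1
    · exact ih hχ' ha.2 hb.2 hφ

/-! ### Finite sets of guarded formulas that determine local equivalence, and their first-order
translations. -/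

section Basis

variable (L) [Finite (Σ m, L.Relations m)]

/-- The list is finite because the vocabulary is. -/
noncomputable def atoms (m : ℕ) : List (Guarded L m) :=
  ((Set.finite_range fun p : Fin m × Fin m => (eq p.1 p.2 : Guarded L m)).union
    (Set.finite_range fun p : (R : Σ n, L.Relations n) × (Fin R.1 → Fin m) =>
      (rel p.1.2 p.2 : Guarded L m))).toFinset.toList

variable {L} in
lemma eq_mem_atoms (i j : Fin m) : (eq i j : Guarded L m) ∈ atoms L m := by
  simp only [atoms, Finset.mem_toList, Set.Finite.mem_toFinset]
  exact Or.inl ⟨(i, j), rfl⟩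

variable {L} in
lemma rel_mem_atoms {n : ℕ} (R : L.Relations n) (xs : Fin n → Fin m) :
    (rel R xs : Guarded L m) ∈ atoms L m := by
  simp only [atoms, Finset.mem_toList, Set.Finite.mem_toFinset]
  exact Or.inr ⟨⟨⟨n, R⟩, xs⟩, rfl⟩

/-- Formulas that determine the local equivalence with `q` rounds. -/
noncomputable def basis : ℕ → (m : ℕ) → List (Guarded L m)
  | 0, m => atoms L m
  | q + 1, m => atoms L m ++
      (List.finRange m).flatMap fun i => (types (basis q (m + 1))).map fun χ => ex i χ

/-- All Boolean combinations of the formulas in the basis, up to equivalence. -/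
noncomputable def candidates (q m : ℕ) : List (Guarded L m) :=
  (types (basis L q m)).sublists.map disj

variable {L}

lemma partialIso_of_atoms {a b : Fin m → U}
    (h : ∀ φ ∈ atoms L m, φ.Realize a ↔ φ.Realize b) :
    PartialIso L (Set.range fun i => (a i, b i)) := by
  refine ⟨?_, fun n R xs ys hs => ?_⟩
  · rintro _ ⟨i, rfl⟩ _ ⟨j, rfl⟩
    exact h _ (eq_mem_atoms i j)
  · choose i hi using hs
    simp only [Prod.mk.injEq] at hi
    have hx : xs = fun j => a (i j) := funext fun j => (hi j).1.symm
    have hy : ys = fun j => b (i j) := funext fun j => (hi j).2.symm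
    rw [hx, hy]
    exact h _ (rel_mem_atoms R i)

lemma atoms_subset_basis (q m : ℕ) : atoms L m ⊆ basis L q m := by
  cases q with
  | zero => exact fun _ h => h
  | succ q => exact List.subset_append_left _ _

lemma range_snoc (a b : Fin m → U) (z z' : U) :
    insert (z, z') (Set.range fun i => (a i, b i)) ⊆
      Set.range fun i => (Fin.snoc (α := fun _ => U) a z i, Fin.snoc (α := fun _ => U) b z' i) := by
  rintro p (rfl | ⟨i, rfl⟩)
  · exact ⟨Fin.last m, by simp⟩
  · exact ⟨i.castSucc, by simp⟩

/-- A new neighbour of the i-th element is answered through the complete type χ of the extended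
tuple: it is one of finitely many, and `ex i χ` belongs to the basis of the next rank. -/
lemma locEquiv_of_basis {q : ℕ} {a b : Fin m → U}
    (h : ∀ φ ∈ basis L q m, φ.Realize a ↔ φ.Realize b) :
    LocEquiv L q (Set.range fun i => (a i, b i)) := by
  induction q generalizing m with
  | zero => exact partialIso_of_atoms h
  | succ q ih =>
    have hmem : ∀ i : Fin m, ∀ χ ∈ types (basis L q (m + 1)), ex i χ ∈ basis L (q + 1) m := by
      intro i χ hχ
      refine List.mem_append_right _ (List.mem_flatMap.2 ⟨i, List.mem_finRange i, ?_⟩)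
      exact List.mem_map_of_mem hχ
    refine ⟨partialIso_of_atoms fun φ hφ => h φ (atoms_subset_basis _ _ hφ), ?_⟩
    rintro _ ⟨i, rfl⟩
    refine ⟨fun z hz => ?_, fun z' hz' => ?_⟩
    · obtain ⟨χ, hχ, hχa⟩ := exists_mem_types (basis L q (m + 1)) (Fin.snoc (α := fun _ => U) a z)
      obtain ⟨z', hz', hχb⟩ := (h _ (hmem i χ hχ)).1 ⟨z, hz, hχa⟩
      exact ⟨z', hz', (ih fun φ hφ => realize_iff_of_mem_types hχ hχa hχb hφ).mono
        (range_snoc a b z z')⟩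
    · obtain ⟨χ, hχ, hχb⟩ := exists_mem_types (basis L q (m + 1)) (Fin.snoc (α := fun _ => U) b z')
      obtain ⟨z, hz, hχa⟩ := (h _ (hmem i χ hχ)).2 ⟨z', hz', hχb⟩
      exact ⟨z, hz, (ih fun φ hφ => realize_iff_of_mem_types hχ hχa hχb hφ).mono
        (range_snoc a b z z')⟩

/-- A labelling that respects local equivalence is given by a guarded formula. -/
lemma exists_mem_candidates {q : ℕ} {ι : Type*} (a : ι → Fin m → U) (c : ι → Prop)
    (h : ∀ i j, LocEquiv L q (Set.range fun x => (a i x, a j x)) → (c i ↔ c j)) :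
    ∃ φ ∈ candidates L q m, ∀ i, φ.Realize (a i) ↔ c i := by
  classical
  -- The types realised by positive tuples: a tuple with such a type is locally equivalent to a
  -- positive one, hence positive.
  refine ⟨disj ((types (basis L q m)).filter fun χ => ∃ i, c i ∧ χ.Realize (a i)),
    List.mem_map_of_mem (List.mem_sublists.2 List.filter_sublist), fun i => ?_⟩
  simp only [realize_disj, List.mem_filter, decide_eq_true_eq]
  constructor
  · rintro ⟨χ, ⟨hχ, j, hj, hχj⟩, hχi⟩
    exact (h i j (locEquiv_of_basis fun φ hφ => realize_iff_of_mem_types hχ hχi hχj hφ)).2 hj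
  · intro hi
    obtain ⟨χ, hχ, hχi⟩ := exists_mem_types (basis L q m) (a i)
    exact ⟨χ, ⟨hχ, i, hi, hχi⟩, hχi⟩

/-- Adjacency in the Gaifman graph is first-order definable. -/
lemma exists_adj_formula (L : FirstOrder.Language.{u, v}) [Finite (Σ m, L.Relations m)] :
    ∃ φ : L.Formula (Fin 2), ∀ (U : Type w) [L.Structure U] (a : Fin 2 → U),
      φ.Realize a ↔ (gaifmanGraph L U).Adj (a 0) (a 1) := by
  let occ : ((R : Σ n, L.Relations n) × (Fin R.1 × Fin R.1)) → L.Formula (Fin 2) := fun p =>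
    FirstOrder.Language.Formula.iExs (Fin p.1.1)
      (FirstOrder.Language.Relations.formula p.1.2 (fun i =>
        (FirstOrder.Language.Term.var (Sum.inr i) : L.Term (Fin 2 ⊕ Fin p.1.1))) ⊓
        (FirstOrder.Language.Term.equal (FirstOrder.Language.Term.var (Sum.inr p.2.1))
          (FirstOrder.Language.Term.var (Sum.inl 0)) ⊓
        FirstOrder.Language.Term.equal (FirstOrder.Language.Term.var (Sum.inr p.2.2))
          (FirstOrder.Language.Term.var (Sum.inl 1))))
  refine ⟨∼(FirstOrder.Language.Term.equal (FirstOrder.Language.Term.var 0)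
    (FirstOrder.Language.Term.var 1)) ⊓ FirstOrder.Language.Formula.iSup occ,
    fun U _ a => ?_⟩
  simp only [FirstOrder.Language.Formula.realize_inf, FirstOrder.Language.Formula.realize_not,
    FirstOrder.Language.Formula.realize_equal, FirstOrder.Language.Formula.realize_iSup,
    FirstOrder.Language.Formula.realize_iExs, FirstOrder.Language.Term.realize_var, occ,
    FirstOrder.Language.Formula.realize_rel, Sum.elim_inr, Sum.elim_inl]
  refine and_congr Iff.rfl ⟨?_, ?_⟩
  · rintro ⟨⟨⟨n, R⟩, i, j⟩, xs, hR, hi, hj⟩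
    exact ⟨n, R, xs, hR, ⟨i, hi⟩, ⟨j, hj⟩⟩
  · rintro ⟨n, R, xs, hR, ⟨i, hi⟩, ⟨j, hj⟩⟩
    exact ⟨⟨⟨n, R⟩, i, j⟩, xs, hR, hi, hj⟩

/-- The guards are spelled out by the definition of adjacency. The formula is independent of the
structure, so the list of possible outputs can be fixed in advance. -/
lemma exists_formula (φ : Guarded L m) :
    ∃ ψ : L.Formula (Fin m), ∀ (U : Type w) [L.Structure U] (a : Fin m → U),
      ψ.Realize a ↔ φ.Realize a := by
  induction φ with
  | falsum => exact ⟨⊥, fun U _ a => Iff.rfl⟩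
  | eq i j =>
    exact ⟨FirstOrder.Language.Term.equal (FirstOrder.Language.Term.var i)
      (FirstOrder.Language.Term.var j), fun U _ a => by
        simp [FirstOrder.Language.Formula.realize_equal, Realize]⟩
  | rel R xs =>
    exact ⟨FirstOrder.Language.Relations.formula R fun i => FirstOrder.Language.Term.var (xs i),
      fun U _ a => by simp [FirstOrder.Language.Formula.realize_rel, Realize]⟩
  | imp φ ψ ihφ ihψ =>
    obtain ⟨φ', hφ⟩ := ihφ
    obtain ⟨ψ', hψ⟩ := ihψ
    exact ⟨φ'.imp ψ', fun U _ a => by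
      rw [FirstOrder.Language.Formula.realize_imp, hφ, hψ]; rfl⟩
  | @ex m i φ ih =>
    obtain ⟨φ', hφ⟩ := ih
    obtain ⟨adj, hadj⟩ := exists_adj_formula.{u, v, w} L
    let f : Fin (m + 1) → Fin m ⊕ Fin 1 :=
      Fin.snoc (α := fun _ => Fin m ⊕ Fin 1) (fun j => Sum.inl j) (Sum.inr 0)
    refine ⟨FirstOrder.Language.Formula.iExs (Fin 1)
      (adj.relabel ![Sum.inl i, Sum.inr 0] ⊓ φ'.relabel f), fun U _ a => ?_⟩
    have hf : ∀ z : Fin 1 → U, Sum.elim a z ∘ f = Fin.snoc (α := fun _ => U) a (z 0) := by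
      intro z
      funext j
      refine Fin.lastCases ?_ (fun j => ?_) j <;> simp [f]
    simp only [FirstOrder.Language.Formula.realize_iExs, FirstOrder.Language.Formula.realize_inf,
      FirstOrder.Language.Formula.realize_relabel, hadj, hφ, hf, Realize]
    constructor
    · rintro ⟨z, h1, h2⟩
      exact ⟨z 0, h1, h2⟩
    · rintro ⟨z, h1, h2⟩
      exact ⟨fun _ => z, h1, h2⟩

/-- A first-order formula equivalent to `φ`, with the variables split into two groups. -/
noncomputable def toFormula {k ℓ : ℕ} (φ : Guarded L (k + ℓ)) : L.Formula (Fin k ⊕ Fin ℓ) :=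
  (exists_formula.{u, v, w} φ).choose.relabel finSumFinEquiv.symm

lemma realize_toFormula {k ℓ : ℕ} (φ : Guarded L (k + ℓ)) (us : Fin k → U) (vs : Fin ℓ → U) :
    (toFormula.{u, v, w} φ).Realize (Sum.elim us vs) ↔ φ.Realize (Fin.append us vs) := by
  rw [toFormula, FirstOrder.Language.Formula.realize_relabel,
    (exists_formula.{u, v, w} φ).choose_spec]
  have : Sum.elim us vs ∘ finSumFinEquiv.symm = Fin.append us vs := by
    funext i
    refine Fin.addCases (fun i => ?_) (fun i => ?_) i <;> simp
  rw [this]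

end Basis

end Guarded

/-! ## Parameters near the training examples -/

/-- Take `I` of maximal size among the sets whose members are within |I| * r of `E`. Adding one
index enlarges the radius by r, so an omitted parameter within r of `E` or of a member of `I` could
have been added. -/
lemma exists_near_subset {V : Type w} (G : SimpleGraph V) (E : Set V) {ℓ : ℕ} (vs : Fin ℓ → V)
    (r : ℕ) :
    ∃ I : Finset (Fin ℓ), (∀ i ∈ I, ∃ x ∈ E, Near G (ℓ * r) x (vs i)) ∧
      ∀ j ∉ I, (∀ x ∈ E, ¬ Near G r x (vs j)) ∧ ∀ i ∈ I, ¬ Near G r (vs i) (vs j) := by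
  classical
  let P : Set (Finset (Fin ℓ)) := {I | ∀ i ∈ I, ∃ x ∈ E, Near G (I.card * r) x (vs i)}
  obtain ⟨I, hI, hmax⟩ := Set.exists_max_image P Finset.card (Set.toFinite P) ⟨∅, by simp [P]⟩
  have hcard : I.card ≤ ℓ := by simpa using Finset.card_le_univ I
  have key : ∀ j ∉ I, ¬ ∃ x ∈ E, Near G ((I.card + 1) * r) x (vs j) := by
    rintro j hj ⟨x, hx, h⟩
    have : insert j I ∈ P := by
      intro i hi
      rw [Finset.card_insert_of_notMem hj]
      rcases Finset.mem_insert.1 hi with rfl | hi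
      · exact ⟨x, hx, h⟩
      · obtain ⟨y, hy, h'⟩ := hI i hi
        exact ⟨y, hy, h'.mono (Nat.mul_le_mul_right r (by omega))⟩
    have := hmax _ this
    rw [Finset.card_insert_of_notMem hj] at this
    omega
  refine ⟨I, fun i hi => ?_, fun j hj => ⟨fun x hx h => ?_, fun i hi h => ?_⟩⟩
  · obtain ⟨x, hx, h⟩ := hI i hi
    exact ⟨x, hx, h.mono (Nat.mul_le_mul_right r hcard)⟩
  · exact key j hj ⟨x, hx, h.mono (by nlinarith [Nat.zero_le (I.card * r)])⟩
  · obtain ⟨x, hx, h'⟩ := hI i hi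
    exact key j hj ⟨x, hx, (h'.trans h).mono (by rw [add_mul, one_mul])⟩

/-- If some hypothesis of quantifier rank `q` is consistent with a training sequence, then so is one
that is given by a candidate formula with parameters near the training examples. -/
theorem exists_consistent_candidate {L : FirstOrder.Language.{u, v}} [L.IsRelational]
    [Finite (Σ m, L.Relations m)] {U : Type w} [Finite U] [L.Structure U] {k ℓ q : ℕ}
    {T : List ((Fin k → U) × Bool)} (hT : 0 < ℓ → 0 < k ∧ T ≠ [])
    {φ : L.Formula (Fin k ⊕ Fin ℓ)} {vs : Fin ℓ → U} (hφ : quantifierRank φ ≤ q)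
    (hcons : Consistent (hypothesis φ vs) T) :
    ∃ ψ ∈ Guarded.candidates L (localRank q (k + ℓ)) (k + ℓ), ∃ ws : Fin ℓ → U,
      (∀ j, ∃ e ∈ T, ∃ i, Near (gaifmanGraph L U) (ℓ * (localRank q (k + ℓ) + 1))
        (e.1 i) (ws j)) ∧
      ∀ e ∈ T, ψ.Realize (Fin.append e.1 ws) ↔ e.2 = true := by
  classical
  set Q := localRank q (k + ℓ) with hQ
  -- Q + 1 is the separation that `LocEquiv.union` needs for Q rounds.
  obtain ⟨I, hI, hfar⟩ := exists_near_subset (gaifmanGraph L U) {x | ∃ e ∈ T, ∃ i, e.1 i = x} vs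
    (Q + 1)
  -- Far parameters are replaced by an arbitrary training element; this is why one has to exist when
  -- ℓ > 0.
  have hws : ∃ ws : Fin ℓ → U, (∀ i ∈ I, ws i = vs i) ∧
      ∀ j, ∃ e ∈ T, ∃ i, Near (gaifmanGraph L U) (ℓ * (Q + 1)) (e.1 i) (ws j) := by
    have : ∀ j : Fin ℓ, ∃ w, (j ∈ I → w = vs j) ∧
        ∃ e ∈ T, ∃ i, Near (gaifmanGraph L U) (ℓ * (Q + 1)) (e.1 i) w := by
      intro j
      by_cases hj : j ∈ I
      · obtain ⟨_, ⟨e, he, i, rfl⟩, h⟩ := hI j hj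
        exact ⟨vs j, fun _ => rfl, e, he, i, h⟩
      · obtain ⟨hk, hne⟩ := hT (Fin.pos j)
        obtain ⟨e, he⟩ := List.exists_mem_of_ne_nil T hne
        exact ⟨e.1 ⟨0, hk⟩, fun h => absurd h hj, e, he, ⟨0, hk⟩, Near.refl _ _⟩
    choose ws h1 h2 using this
    exact ⟨ws, h1, h2⟩
  obtain ⟨ws, hws, hnear⟩ := hws
  suffices key : ∀ e ∈ T, ∀ e' ∈ T, LocEquiv L Q (Set.range fun x =>
      (Fin.append e.1 ws x, Fin.append e'.1 ws x)) → (e.2 = true ↔ e'.2 = true) by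
    obtain ⟨ψ, hψ, h⟩ := Guarded.exists_mem_candidates (L := L) (q := Q)
      (fun e : {e // e ∈ T} => Fin.append e.1.1 ws) (fun e => e.1.2 = true)
      (fun e e' => key e.1 e.2 e'.1 e'.2)
    exact ⟨ψ, hψ, ws, hnear, fun e he => h ⟨e, he⟩⟩
  intro e he e' he' hloc
  have hl : LocEquiv L Q (Set.range fun i => (e.1 i, e'.1 i)) :=
    hloc.mono (by rintro _ ⟨i, rfl⟩; exact ⟨Fin.castAdd ℓ i, by simp⟩)
  have hl : LocEquiv L Q ((Set.range fun i => (e.1 i, e'.1 i)) ∪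
      {p | ∃ i ∈ I, p = (vs i, vs i)}) := by
    refine hloc.mono ?_
    rintro _ (⟨i, rfl⟩ | ⟨i, hi, rfl⟩)
    · exact ⟨Fin.castAdd ℓ i, by simp⟩
    · exact ⟨Fin.natAdd k i, by simp [hws i hi]⟩
  -- The far original parameters are put back, each matched with itself; they are separated from
  -- both examples and from the kept parameters.
  have hd : LocEquiv L Q {p | ∃ i ∉ I, p = (vs i, vs i)} :=
    LocEquiv.diagonal (by rintro _ ⟨i, _, rfl⟩; rfl)
  have hu := hl.union hd
    (by
      rintro _ (⟨i, rfl⟩ | ⟨i, hi, rfl⟩) _ ⟨j, hj, rfl⟩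
      · exact (hfar j hj).1 _ ⟨e, he, i, rfl⟩
      · exact (hfar j hj).2 i hi)
    (by
      rintro _ (⟨i, rfl⟩ | ⟨i, hi, rfl⟩) _ ⟨j, hj, rfl⟩
      · exact (hfar j hj).1 _ ⟨e', he', i, rfl⟩
      · exact (hfar j hj).2 i hi)
  let g : Fin k ⊕ Fin ℓ → U × U :=
    Sum.elim (fun i => (e.1 i, e'.1 i)) (fun j => (vs j, vs j))
  have hr : LocEquiv L Q (Set.range g) := by
    refine hu.mono ?_
    rintro _ ⟨i | j, rfl⟩
    · exact Or.inl (Or.inl ⟨i, rfl⟩)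
    · by_cases hj : j ∈ I
      · exact Or.inl (Or.inr ⟨j, hj, rfl⟩)
      · exact Or.inr ⟨j, hj, rfl⟩
  have hcard : (Set.range g).ncard ≤ k + ℓ := by
    rw [← Set.image_univ]
    refine (Set.ncard_image_le Set.finite_univ).trans ?_
    simp [Set.ncard_univ]
  have hEF := hr.efEquiv (Set.finite_range g) hcard
  have hiff : φ.Realize (Sum.elim e.1 vs) ↔ φ.Realize (Sum.elim e'.1 vs) := by
    refine EFEquiv.realize_iff φ hφ hEF ?_ (fun i => i.elim0)
    rintro (i | j)
    · exact ⟨Sum.inl i, rfl⟩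
    · exact ⟨Sum.inr j, rfl⟩
  have h1 := hcons e he; have h2 := hcons e' he'
  rw [← h1, ← h2]
  simpa [hypothesis] using hiff

/-! ## Running times counted in steps -/

section Runs

variable {L : FirstOrder.Language.{u, v}} {U : Type w} [L.Structure U]

variable (L U) in
/-- A bound on the cost of a single instruction or test. -/
noncomputable def unitCost : ℕ := 1 + 2 * eltSize U + maxDegree L U * eltSize U

/-- `p` leads from `s` to `s'` in at most `n` steps of cost at most `unitCost L U` each. -/
def Runs (A : LocalAccess L U) (p : Program L) (s s' : Store U) (n : ℕ) : Prop :=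
  ∃ c, Exec A p s s' c ∧ c ≤ n * unitCost L U

lemma LocalAccess.length_nbrs_le [Finite U] (A : LocalAccess L U) (a : U) :
    (A.nbrs a).length ≤ maxDegree L U := by
  classical
  have h : ((gaifmanGraph L U).neighborSet a).ncard = (A.nbrs a).length := by
    rw [← List.toFinset_card_of_nodup (A.nodup_nbrs a), ← Set.ncard_coe_finset]
    congr 1
    ext b
    simp [A.mem_nbrs]
  rw [← h]
  exact le_ciSup (f := fun a => ((gaifmanGraph L U).neighborSet a).ncard)
    (Set.finite_range _).bddAbove a

lemma Cell.size_le (c : Cell U) : c.size ≤ eltSize U := by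
  cases c <;> simp [Cell.size, eltSize]

lemma topSize_le (s : Store U) (x : ℕ) : topSize s x ≤ eltSize U := by
  unfold topSize
  split
  · simp
  · exact Cell.size_le _

lemma Instr.cost_le [Finite U] (A : LocalAccess L U) (i : Instr) (s : Store U) :
    i.cost A s ≤ unitCost L U := by
  unfold unitCost
  cases i with
  | push x b => simp only [Instr.cost]; omega
  | pop x => have := topSize_le s x; simp only [Instr.cost]; omega
  | copy x y => have := topSize_le s x; simp only [Instr.cost]; omega
  | nbr x y =>
    simp only [Instr.cost]
    split
    · have := Nat.mul_le_mul_right (eltSize U) (A.length_nbrs_le ‹U›)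
      omega
    · omega

lemma Test.cost_le (t : Test L) (s : Store U) : t.cost s ≤ unitCost L U := by
  unfold unitCost
  unfold Test.cost
  split
  · have := topSize_le s ‹_›
    rename_i x y
    have h1 := topSize_le s x
    have h2 := topSize_le s y
    omega
  · omega

namespace Runs

variable {A : LocalAccess L U} {p q : Program L} {s s' s'' : Store U} {n n' : ℕ}

lemma mono (h : Runs A p s s' n) (hn : n ≤ n') : Runs A p s s' n' := by
  obtain ⟨c, hc, hle⟩ := h
  exact ⟨c, hc, hle.trans (Nat.mul_le_mul_right _ hn)⟩

lemma basic [Finite U] (i : Instr) (s : Store U) : Runs A (.basic i) s (i.apply A s) 1 :=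
  ⟨_, Exec.basic i s, by simpa using i.cost_le A s⟩

lemma seq (h : Runs A p s s' n) (h' : Runs A q s' s'' n') : Runs A (.seq p q) s s'' (n + n') := by
  obtain ⟨c, hc, hle⟩ := h
  obtain ⟨c', hc', hle'⟩ := h'
  exact ⟨_, Exec.seq hc hc', by rw [add_mul]; omega⟩

lemma ite_pos {t : Test L} (ht : t.Holds s) (h : Runs A p s s' n) :
    Runs A (.ite t p q) s s' (n + 1) := by
  obtain ⟨c, hc, hle⟩ := h
  have := t.cost_le s
  exact ⟨_, Exec.ite_pos ht hc, by rw [add_mul]; omega⟩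

lemma ite_neg {t : Test L} (ht : ¬ t.Holds s) (h : Runs A q s s' n) :
    Runs A (.ite t p q) s s' (n + 1) := by
  obtain ⟨c, hc, hle⟩ := h
  have := t.cost_le s
  exact ⟨_, Exec.ite_neg ht hc, by rw [add_mul]; omega⟩

lemma loop_pos {t : Test L} (ht : t.Holds s) (h : Runs A p s s' n)
    (h' : Runs A (.loop t p) s' s'' n') : Runs A (.loop t p) s s'' (n + 1 + n') := by
  obtain ⟨c, hc, hle⟩ := h
  obtain ⟨c', hc', hle'⟩ := h'
  have := t.cost_le s
  exact ⟨_, Exec.loop_pos ht hc hc', by rw [add_mul, add_mul]; omega⟩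

lemma loop_neg {t : Test L} (ht : ¬ t.Holds s) : Runs A (.loop t p) s s 1 :=
  ⟨_, Exec.loop_neg ht, by simpa using t.cost_le s⟩

lemma congr_post (h : Runs A p s s' n) (hs : s' = s'') : Runs A p s s'' n := hs ▸ h

end Runs

/-- Do nothing. -/
def Program.skip : Program L := .seq (.basic (.push 0 true)) (.basic (.pop 0))

lemma Runs.skip [Finite U] {A : LocalAccess L U} (s : Store U) : Runs A .skip s s 2 := by
  have h := (Runs.basic (A := A) (.push 0 true) s).seq (Runs.basic (.pop 0) _)
  simpa [Program.skip, Instr.apply] using h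

/-- Execute a list of instructions. -/
def Program.instrs : List Instr → Program L
  | [] => .skip
  | i :: l => .seq (.basic i) (instrs l)

lemma Runs.instrs [Finite U] {A : LocalAccess L U} (l : List Instr) (s : Store U) :
    Runs A (.instrs l) s (l.foldl (fun s i => i.apply A s) s) (l.length + 2) := by
  induction l generalizing s with
  | nil => exact (Runs.skip s)
  | cons i l ih => exact ((Runs.basic i s).seq (ih _)).mono (by simp; omega)

end Runs

/-! ## Evaluation of guarded formulas -/

namespace Guarded

variable {L : FirstOrder.Language.{u, v}} {U : Type w} [L.Structure U]

/-- A program that evaluates a guarded formula. The value of variable `i` is on top of the stack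
`x i`, the stacks from `f` on are empty, and the truth value is pushed on stack `r`. -/
def program : {m : ℕ} → Guarded L m → (Fin m → ℕ) → ℕ → ℕ → Program L
  | _, falsum, _, _, r => .basic (.push r false)
  | _, eq i j, x, _, r =>
    .ite (.same (x i) (x j)) (.basic (.push r true)) (.basic (.push r false))
  | _, rel R xs, x, _, r =>
    .ite (.rel R fun i => x (xs i)) (.basic (.push r true)) (.basic (.push r false))
  | _, imp φ ψ, x, f, r =>
    .seq (φ.program x f r) (.ite (.isBit r true)
      (.seq (.basic (.pop r)) (ψ.program x f r))
      (.seq (.basic (.pop r)) (.basic (.push r true))))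
  -- Once the bit on `r` is true, the remaining neighbours are popped without evaluation, so `f` is
  -- always emptied again.
  | _, ex i φ, x, f, r =>
    .seq (.basic (.push r false)) (.seq (.basic (.nbr (x i) f))
      (.loop (.nonempty f) (.ite (.isBit r true) (.basic (.pop f))
        (.seq (.basic (.pop r)) (.seq
          (φ.program (Fin.snoc (α := fun _ => ℕ) x f) (f + 1) r) (.basic (.pop f)))))))

/-- A bound on the number of steps of the evaluation in structures of degree at most `d`. -/
def steps : {m : ℕ} → Guarded L m → ℕ → ℕ
  | _, falsum, _ => 1
  | _, eq _ _, _ => 2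
  | _, rel _ _, _ => 2
  | _, imp φ ψ, d => φ.steps d + ψ.steps d + 4
  | _, ex _ φ, d => 3 + d * (φ.steps d + 4)

-- All stacks except `r` are restored exactly, which lets evaluations be nested. Variables must not
-- live on `r`, where truth values would cover them.
open Classical in
theorem runs_program [Finite U] {A : LocalAccess L U} {m : ℕ} (φ : Guarded L m) {d : ℕ}
    (hd : maxDegree L U ≤ d) (x : Fin m → ℕ) (f r : ℕ) (s : Store U) (a : Fin m → U)
    (hx : ∀ i, (s (x i)).head? = some (.elt (a i))) (hxf : ∀ i, x i < f) (hxr : ∀ i, x i ≠ r)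
    (hrf : r < f) (hf : ∀ y, f ≤ y → s y = []) :
    Runs A (φ.program x f r) s (Function.update s r (.bit (decide (φ.Realize a)) :: s r))
      (φ.steps d) := by
  induction φ generalizing f s with
  | falsum =>
    have h : decide ((falsum : Guarded L _).Realize a) = false := decide_eq_false fun h => h
    rw [h]
    exact Runs.basic (.push r false) s
  | eq i j =>
    have key : Test.Holds (L := L) (.same (x i) (x j)) s ↔ a i = a j := by
      simp only [Test.Holds, hx]
      constructor
      · rintro ⟨c, h1, h2⟩
        simpa using h1.trans h2.symm
      · intro h
        exact ⟨_, rfl, by rw [h]⟩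
    by_cases h : a i = a j
    · simpa [program, steps, Realize, h, Instr.apply] using Runs.ite_pos (q := .basic (.push r false)) (key.2 h)
        (Runs.basic (A := A) (.push r true) s)
    · simpa [program, steps, Realize, h, Instr.apply] using Runs.ite_neg (p := .basic (.push r true))
        (fun h' => h (key.1 h')) (Runs.basic (A := A) (.push r false) s)
  | rel R xs =>
    have key : (Test.rel R fun i => x (xs i)).Holds s ↔
        FirstOrder.Language.Structure.RelMap R fun i => a (xs i) := by
      simp only [Test.Holds, hx]
      constructor
      · rintro ⟨as, h1, h2⟩
        have : as = fun i => a (xs i) := funext fun i => by simpa using (h1 i).symm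
        rwa [← this]
      · intro h
        exact ⟨_, fun i => rfl, h⟩
    by_cases h : FirstOrder.Language.Structure.RelMap R fun i => a (xs i)
    · simpa [program, steps, Realize, h, Instr.apply] using Runs.ite_pos (q := .basic (.push r false)) (key.2 h)
        (Runs.basic (A := A) (.push r true) s)
    · simpa [program, steps, Realize, h, Instr.apply] using Runs.ite_neg (p := .basic (.push r true))
        (fun h' => h (key.1 h')) (Runs.basic (A := A) (.push r false) s)
  | imp φ ψ ihφ ihψ =>
    have h1 := ihφ x f s a hx hxf hxr hrf hf
    have h2 := ihψ x f s a hx hxf hxr hrf hf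
    have hpop := Runs.basic (A := A) (.pop r)
      (Function.update s r (.bit (decide (φ.Realize a)) :: s r))
    simp only [Instr.apply, Function.update_self, List.tail_cons, Function.update_idem,
      Function.update_eq_self] at hpop
    by_cases h : φ.Realize a
    · have h3 := h1.seq (Runs.ite_pos (t := .isBit r true)
        (q := .seq (.basic (.pop r)) (.basic (.push r true))) (by simp [Test.Holds, h])
        (hpop.seq h2))
      refine Runs.mono (n := φ.steps d + (1 + ψ.steps d + 1)) ?_ (by simp only [steps]; omega)
      simpa [program, Realize, h] using h3
    · have h3 := h1.seq (Runs.ite_neg (t := .isBit r true)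
        (p := .seq (.basic (.pop r)) (ψ.program x f r)) ?_
        (hpop.seq (Runs.basic (.push r true) s)))
      · simp only [Instr.apply] at h3
        refine Runs.mono (n := φ.steps d + (1 + 1 + 1)) ?_ (by simp only [steps]; omega)
        simpa [program, Realize, h] using h3
      · simp [Test.Holds, h]
  | ex i φ ih =>
    -- Loop invariant: `b` is the disjunction over the neighbours already treated, `l` lists those
    -- still to come.
    have loop : ∀ (l : List U) (b : Bool) (t : Store U), t f = l.map .elt →
        t r = .bit b :: s r → (∀ y, y ≠ f → y ≠ r → t y = s y) →
        Runs A (.loop (.nonempty f) (.ite (.isBit r true) (.basic (.pop f))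
          (.seq (.basic (.pop r)) (.seq
            (φ.program (Fin.snoc (α := fun _ => ℕ) x f) (f + 1) r) (.basic (.pop f)))))) t
          (Function.update s r (.bit (b || decide (∃ z ∈ l,
            φ.Realize (Fin.snoc (α := fun _ => U) a z))) :: s r))
          (1 + l.length * (φ.steps d + 4)) := by
      intro l
      induction l with
      | nil =>
        intro b t h1 h2 h3
        have e : t = Function.update s r (.bit (b || decide (∃ z ∈ ([] : List U),
            φ.Realize (Fin.snoc (α := fun _ => U) a z))) :: s r) := by
          funext y
          by_cases hy : y = r
          · subst hy; simp [h2]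
          · by_cases hy' : y = f
            · subst hy'; simp [hy, h1, hf]
            · simp [hy, h3 y hy' hy]
        rw [← e]
        exact (Runs.loop_neg (by simp [Test.Holds, h1])).mono (by simp)
      | cons z l ihl =>
        intro b t h1 h2 h3
        have hne : (Test.nonempty f : Test L).Holds t := by simp [Test.Holds, h1]
        have hfr : f ≠ r := by omega
        cases b with
        | true =>
          have h4 := ihl true (Function.update t f (t f).tail) (by simp [h1])
            (by simp [hfr.symm, h2]) (fun y hy hy' => by simp [hy, h3 y hy hy'])
          have h6 := Runs.loop_pos hne (Runs.ite_pos (t := .isBit r true)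
            (q := .seq (.basic (.pop r)) (.seq
              (φ.program (Fin.snoc (α := fun _ => ℕ) x f) (f + 1) r) (.basic (.pop f))))
            (by simp [Test.Holds, h2]) (Runs.basic (.pop f) t)) h4
          refine (Runs.mono (n' := 1 + (z :: l).length * (φ.steps d + 4)) h6 ?_).congr_post ?_
          · simp only [List.length_cons]; nlinarith
          · simp
        | false =>
          have h5 := ih (Fin.snoc (α := fun _ => ℕ) x f) (f + 1)
            (Function.update t r (s r)) (Fin.snoc (α := fun _ => U) a z)
            (by
              intro j
              refine Fin.lastCases ?_ (fun j => ?_) j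
              · simp [hfr, h1]
              · simp [hxr j, h3 (x j) (hxf j).ne (hxr j), hx j])
            (by
              intro j
              refine Fin.lastCases ?_ (fun j => ?_) j
              · simp
              · simpa using (hxf j).trans (Nat.lt_succ_self f))
            (by
              intro j
              refine Fin.lastCases ?_ (fun j => ?_) j
              · simpa using hfr
              · simpa using hxr j)
            (by omega)
            (fun y hy => by
              have h1 : y ≠ r := by omega
              have h2 : y ≠ f := by omega
              simp [h1, h3 y h2 h1, hf y (by omega)])
          set b' : Bool := decide (φ.Realize (Fin.snoc (α := fun _ => U) a z)) with hb'
          simp only [Function.update_self, Function.update_idem] at h5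
          have h4 := ihl b' (Function.update (Function.update t r (.bit b' :: s r)) f
            (l.map .elt)) (by simp) (by simp [hfr.symm])
            (fun y hy hy' => by simp [hy, hy', h3 y hy hy'])
          have hp : Runs A (.basic (.pop r)) t (Function.update t r (s r)) 1 := by
            simpa [Instr.apply, h2] using Runs.basic (A := A) (.pop r) t
          have hp' : Runs A (.basic (.pop f)) (Function.update t r (.bit b' :: s r))
              (Function.update (Function.update t r (.bit b' :: s r)) f (l.map .elt)) 1 := by
            simpa [Instr.apply, h1, hfr] using
              Runs.basic (A := A) (.pop f) (Function.update t r (.bit b' :: s r))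
          have h6 := Runs.loop_pos hne (Runs.ite_neg (p := .basic (.pop f))
            (t := .isBit r true) (by simp [Test.Holds, h2]) (hp.seq (h5.seq hp'))) h4
          refine (Runs.mono (n' := 1 + (z :: l).length * (φ.steps d + 4)) h6 ?_).congr_post ?_
          · simp only [List.length_cons]; nlinarith
          · simp [hb', Bool.decide_or]
    have hne : x i ≠ r := hxr i
    have h0 : f ≠ r := by omega
    have hn : Runs A (.basic (.nbr (x i) f)) (Function.update s r (.bit false :: s r))
        (Function.update (Function.update s r (.bit false :: s r)) f
          ((A.nbrs (a i)).map .elt)) 1 := by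
      have h := Runs.basic (A := A) (.nbr (x i) f) (Function.update s r (.bit false :: s r))
      obtain ⟨t, ht⟩ : ∃ t, s (x i) = .elt (a i) :: t := by
        have := hx i
        cases hs : s (x i) with
        | nil => simp [hs] at this
        | cons c t => simp [hs] at this; exact ⟨t, by rw [this]⟩
      simpa [Instr.apply, hne, ht, h0, hf f le_rfl] using h
    have h := (Runs.basic (A := A) (.push r false) s).seq (hn.seq
      (loop (A.nbrs (a i)) false _ (by simp) (by simp [h0.symm])
        (fun y hy hy' => by simp [hy, hy'])))
    refine (Runs.mono (n' := 3 + d * (φ.steps d + 4)) h ?_).congr_post ?_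
    · have := Nat.mul_le_mul_right (φ.steps d + 4) ((A.length_nbrs_le (a i)).trans hd)
      omega
    · simp only [Realize, A.mem_nbrs, Bool.false_or]
      congr

end Guarded

/-! ## Moving cells between stacks -/

section Moves

variable {L : FirstOrder.Language.{u, v}} {U : Type w} [L.Structure U] {A : LocalAccess L U}

/-- The effect of a list of instructions. -/
def Instr.run (A : LocalAccess L U) (l : List Instr) (s : Store U) : Store U :=
  l.foldl (fun s i => i.apply A s) s

@[simp] lemma Instr.run_nil (s : Store U) : Instr.run A [] s = s := rfl

@[simp] lemma Instr.run_cons (i : Instr) (l : List Instr) (s : Store U) :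
    Instr.run A (i :: l) s = Instr.run A l (i.apply A s) := rfl

lemma Instr.run_append (l l' : List Instr) (s : Store U) :
    Instr.run A (l ++ l') s = Instr.run A l' (Instr.run A l s) := List.foldl_append

lemma Instr.run_push_bits (bits : List Bool) (x : ℕ) (s : Store U) :
    Instr.run A (bits.reverse.map (.push x)) s =
      Function.update s x (bits.map .bit ++ s x) := by
  induction bits generalizing s with
  | nil => simp
  | cons b bits ih =>
    rw [List.reverse_cons, List.map_append, Instr.run_append, ih]
    simp [Instr.apply]

lemma Instr.run_copy_tops (srcs : List (ℕ × Cell U)) (x : ℕ) (s : Store U)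
    (h : ∀ p ∈ srcs, p.1 ≠ x ∧ (s p.1).head? = some p.2) :
    Instr.run A (srcs.map fun p => .copy p.1 x) s =
      Function.update s x ((srcs.map Prod.snd).reverse ++ s x) := by
  induction srcs generalizing s with
  | nil => simp
  | cons p srcs ih =>
    have h0 := h p (by simp)
    have hcopy : (Instr.copy p.1 x).apply A s = Function.update s x (p.2 :: s x) := by
      cases hs : s p.1 with
      | nil => simp [hs] at h0
      | cons c t =>
        have : c = p.2 := by simpa [hs] using h0.2
        simp [Instr.apply, hs, this]
    simp only [List.map_cons, Instr.run_cons, hcopy]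
    rw [ih]
    · simp
    · intro p' hp'
      obtain ⟨h1, h2⟩ := h p' (by simp [hp'])
      exact ⟨h1, by simpa [h1] using h2⟩

/-- Copying the top of one stack to several others. -/
lemma Instr.run_copy_to (dsts : List ℕ) (hnd : dsts.Nodup) (x : ℕ) (hx : x ∉ dsts) (c : Cell U)
    (s : Store U) (hs : (s x).head? = some c) :
    Instr.run A (dsts.map fun y => .copy x y) s = fun y => if y ∈ dsts then c :: s y else s y := by
  induction dsts generalizing s with
  | nil => simp
  | cons d dsts ih =>
    simp only [List.mem_cons, not_or, List.nodup_cons] at hx hnd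
    have hcopy : (Instr.copy x d).apply A s = Function.update s d (c :: s d) := by
      cases h : s x with
      | nil => simp [h] at hs
      | cons c' t =>
        have : c' = c := by simpa [h] using hs
        simp [Instr.apply, h, this]
    simp only [List.map_cons, Instr.run_cons, hcopy]
    rw [ih hnd.2 hx.2 _ (by simpa [hx.1] using hs)]
    funext y
    by_cases hy : y = d
    · subst hy; simp [hnd.1]
    · simp [hy]

/-- Distribute the top cells of stack `0` to other stacks. -/
def deal (cols : List ℕ) : List Instr := cols.flatMap fun y => [.copy 0 y, .pop 0]

lemma length_deal (cols : List ℕ) : (deal cols).length = 2 * cols.length := by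
  simp [deal, mul_comm]

lemma Instr.run_deal (l : List (ℕ × Cell U)) (hnd : (l.map Prod.fst).Nodup)
    (h0 : 0 ∉ l.map Prod.fst) (rest : List (Cell U)) (s : Store U)
    (hs : s 0 = l.map Prod.snd ++ rest) :
    Instr.run A (deal (l.map Prod.fst)) s 0 = rest ∧
      (∀ p ∈ l, Instr.run A (deal (l.map Prod.fst)) s p.1 = p.2 :: s p.1) ∧
      ∀ y ≠ 0, y ∉ l.map Prod.fst → Instr.run A (deal (l.map Prod.fst)) s y = s y := by
  induction l generalizing s with
  | nil => simpa [deal] using hs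
  | cons p l ih =>
    simp only [List.map_cons, List.nodup_cons, List.mem_cons, not_or, List.cons_append]
      at hnd h0 hs
    have e : Instr.run A (deal (List.map Prod.fst (p :: l))) s =
        Instr.run A (deal (List.map Prod.fst l)) (Function.update (Function.update s p.1
          (p.2 :: s p.1)) 0 (l.map Prod.snd ++ rest)) := by
      simp [deal, Instr.apply, hs, h0.1]
    obtain ⟨h1, h2, h3⟩ := ih hnd.2 h0.2 (Function.update (Function.update s p.1
          (p.2 :: s p.1)) 0 (l.map Prod.snd ++ rest)) (by simp)
    rw [e]
    refine ⟨h1, ?_, ?_⟩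
    · intro p' hp'
      rcases List.mem_cons.1 hp' with rfl | hp'
      · rw [h3 _ (Ne.symm h0.1) hnd.1]
        simp [Ne.symm h0.1]
      · rw [h2 _ hp']
        have h4 : p'.1 ≠ 0 := fun h => h0.2 (h ▸ List.mem_map_of_mem hp')
        have h5 : p'.1 ≠ p.1 := fun h => hnd.1 (h ▸ List.mem_map_of_mem hp')
        simp [h4, h5]
    · intro y hy hyl
      simp only [List.map_cons, List.mem_cons, not_or] at hyl
      rw [h3 y hy hyl.2]
      simp [hy, hyl.1]

end Moves

/-! ## Simultaneous iteration over several stacks -/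

section ForEach

variable {L : FirstOrder.Language.{u, v}} {U : Type w} [L.Structure U] {A : LocalAccess L U}

/-- The stacks after `i` steps of an iteration over the stacks `cols`: the first `i` cells of
each stack `y` in `cols` have been moved to the stack `y + off`. -/
def zipper (cols : List ℕ) (off i : ℕ) (s : Store U) : Store U := fun y =>
  if y ∈ cols then (s y).drop i
  else if off ≤ y ∧ y - off ∈ cols then ((s (y - off)).take i).reverse ++ s y else s y

lemma zipper_zero (cols : List ℕ) (off : ℕ) (s : Store U) : zipper cols off 0 s = s := by
  funext y
  simp [zipper]

lemma zipper_of_mem {cols : List ℕ} {off i : ℕ} {s : Store U} {y : ℕ} (hy : y ∈ cols) :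
    zipper cols off i s y = (s y).drop i := by simp [zipper, hy]

lemma zipper_of_notMem {cols : List ℕ} {off i : ℕ} {s : Store U} {y : ℕ} (hy : y ∉ cols)
    (hy' : ∀ x ∈ cols, y ≠ x + off) : zipper cols off i s y = s y := by
  have : ¬ (off ≤ y ∧ y - off ∈ cols) := fun h => hy' _ h.2 (by omega)
  simp [zipper, hy, this]

lemma zipper_add {cols : List ℕ} {off i : ℕ} {s : Store U} {y : ℕ} (hy : y ∈ cols)
    (hlt : ∀ x ∈ cols, x < off) :
    zipper cols off i s (y + off) = ((s y).take i).reverse ++ s (y + off) := by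
  have : y + off ∉ cols := fun h => by have := hlt _ h; omega
  simp [zipper, hy, this]

lemma zipper_update {cols : List ℕ} {off i : ℕ} {s : Store U} {z : ℕ} (o : List (Cell U))
    (hz : z ∉ cols) (hz' : ∀ x ∈ cols, z ≠ x + off) :
    zipper cols off i (Function.update s z o) = Function.update (zipper cols off i s) z o := by
  have h : ¬ (off ≤ z ∧ z - off ∈ cols) := fun h => hz' _ h.2 (by omega)
  funext y
  by_cases hy : y = z
  · subst hy
    simp [zipper, hz, h]
  · by_cases hy2 : off ≤ y ∧ y - off ∈ cols
    · have : y - off ≠ z := fun h => hz (h ▸ hy2.2)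
      simp [zipper, hy, this]
    · simp [zipper, hy, hy2]

def shiftForth (cols : List ℕ) (off : ℕ) : List Instr :=
  cols.flatMap fun y => [.copy y (y + off), .pop y]

def shiftBack (cols : List ℕ) (off : ℕ) : List Instr :=
  cols.flatMap fun y => [.copy (y + off) y, .pop (y + off)]

lemma length_shiftForth (cols : List ℕ) (off : ℕ) :
    (shiftForth cols off).length = 2 * cols.length := by
  simp [shiftForth, mul_comm]

lemma length_shiftBack (cols : List ℕ) (off : ℕ) :
    (shiftBack cols off).length = 2 * cols.length := by
  simp [shiftBack, mul_comm]

lemma Instr.run_move {x y : ℕ} (hxy : x ≠ y) (s : Store U) :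
    Instr.run A [.copy x y, .pop x] s =
      Function.update (Function.update s y ((s x).take 1 ++ s y)) x (s x).tail := by
  cases h : s x with
  | nil =>
    funext z
    by_cases hz : z = x
    · subst hz; simp [Instr.apply, h]
    · by_cases hz' : z = y
      · subst hz'; simp [Instr.apply, h, hz]
      · simp [Instr.apply, h, hz]
  | cons c t => simp [Instr.apply, h, hxy]

lemma Instr.run_shiftForth {cols : List ℕ} {off : ℕ} (hnd : cols.Nodup)
    (hlt : ∀ x ∈ cols, x < off) (s : Store U) :
    Instr.run A (shiftForth cols off) s = fun y =>
      if y ∈ cols then (s y).tail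
      else if off ≤ y ∧ y - off ∈ cols then (s (y - off)).take 1 ++ s y else s y := by
  induction cols generalizing s with
  | nil => simp [shiftForth]
  | cons c cols ih =>
    simp only [List.nodup_cons] at hnd
    have hc := hlt c (by simp)
    have e : Instr.run A (shiftForth (c :: cols) off) s = Instr.run A (shiftForth cols off)
        (Instr.run A [.copy c (c + off), .pop c] s) := by
      rw [← Instr.run_append]; rfl
    rw [e, Instr.run_move (by omega), ih hnd.2 fun x hx => hlt x (by simp [hx])]
    funext y
    by_cases hy : y = c
    · subst hy
      have : ¬ off ≤ y := by omega
      simp [hnd.1, this]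
    · by_cases hy2 : y = c + off
      · subst hy2
        have : c + off ∉ cols := fun h => by have := hlt _ (List.mem_cons_of_mem _ h); omega
        have h3 : ¬ off = 0 := by omega
        simp [hnd.1, this, h3]
      · have h2 : off ≤ y → y - off ≠ c := by omega
        by_cases h3 : y ∈ cols
        · simp [h3, hy, hy2]
        · by_cases h4 : off ≤ y ∧ y - off ∈ cols
          · have h5 : y - off ≠ c := h2 h4.1
            have h6 : y - off ≠ c + off := fun h => by
              have := hlt _ (List.mem_cons_of_mem _ h4.2); omega
            simp [h3, h4, hy, hy2, h5, h6]
          · have h5 : ¬ (off ≤ y ∧ (y - off = c ∨ y - off ∈ cols)) := by tauto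
            simp [h3, h4, hy, hy2, h5]

lemma Instr.run_shiftBack {cols : List ℕ} {off : ℕ} (hnd : cols.Nodup)
    (hlt : ∀ x ∈ cols, x < off) (s : Store U) :
    Instr.run A (shiftBack cols off) s = fun y =>
      if y ∈ cols then (s (y + off)).take 1 ++ s y
      else if off ≤ y ∧ y - off ∈ cols then (s y).tail else s y := by
  induction cols generalizing s with
  | nil => simp [shiftBack]
  | cons c cols ih =>
    simp only [List.nodup_cons] at hnd
    have hc := hlt c (by simp)
    have e : Instr.run A (shiftBack (c :: cols) off) s = Instr.run A (shiftBack cols off)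
        (Instr.run A [.copy (c + off) c, .pop (c + off)] s) := by
      rw [← Instr.run_append]; rfl
    rw [e, Instr.run_move (by omega), ih hnd.2 fun x hx => hlt x (by simp [hx])]
    funext y
    have h0 : off ≠ 0 := by omega
    by_cases hy : y = c
    · subst hy
      have : ¬ off ≤ y := by omega
      simp [hnd.1, this, h0]
    · by_cases hy2 : y = c + off
      · subst hy2
        have : c + off ∉ cols := fun h => by have := hlt _ (List.mem_cons_of_mem _ h); omega
        simp [hnd.1, this, h0]
      · have h2 : off ≤ y → y - off ≠ c := by omega
        by_cases h3 : y ∈ cols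
        · have h5 : y + off ≠ c := by omega
          simp [h3, hy, hy2, h5]
        · by_cases h4 : off ≤ y ∧ y - off ∈ cols
          · simp [h3, h4, hy, hy2]
          · have h5 : ¬ (off ≤ y ∧ (y - off = c ∨ y - off ∈ cols)) := by tauto
            simp [h3, h4, hy, hy2, h5]

lemma run_shiftForth_zipper {cols : List ℕ} {off : ℕ} (hnd : cols.Nodup)
    (hlt : ∀ x ∈ cols, x < off) (i : ℕ) (s : Store U) :
    Instr.run A (shiftForth cols off) (zipper cols off i s) = zipper cols off (i + 1) s := by
  rw [Instr.run_shiftForth hnd hlt]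
  funext y
  by_cases hy : y ∈ cols
  · simp [zipper, hy]
  · by_cases hy2 : off ≤ y ∧ y - off ∈ cols
    · have h1 : ∀ l : List (Cell U), (l.take (i + 1)).reverse =
          (l.drop i).take 1 ++ (l.take i).reverse := by
        intro l
        rw [List.take_add, List.reverse_append]
        congr 1
        cases l.drop i <;> simp
      simp [zipper, hy, hy2, h1]
    · simp [zipper, hy, hy2]

/-- The length bound says that row `i` exists in every column, so the tops of the auxiliary stacks
are the cells moved in the last forward step. -/
lemma run_shiftBack_zipper {cols : List ℕ} {off : ℕ} (hnd : cols.Nodup)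
    (hlt : ∀ x ∈ cols, x < off) (i : ℕ) (s : Store U) (hlen : ∀ x ∈ cols, i < (s x).length) :
    Instr.run A (shiftBack cols off) (zipper cols off (i + 1) s) = zipper cols off i s := by
  rw [Instr.run_shiftBack hnd hlt]
  funext y
  by_cases hy : y ∈ cols
  · rw [if_pos hy, zipper_add hy hlt, zipper_of_mem hy, zipper_of_mem hy]
    have h := hlen y hy
    rw [List.drop_eq_getElem_cons h, List.take_succ_eq_append_getElem h]
    simp [-List.take_append_getElem, -List.getElem_cons_drop]
  · by_cases hy2 : off ≤ y ∧ y - off ∈ cols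
    · have h := hlen _ hy2.2
      have e := List.take_succ_eq_append_getElem h
      simp [zipper, hy, hy2, -List.take_append_getElem, e]
    · simp [zipper, hy, hy2]

/-- Execute `body` for each row of the stacks `cols`, of which `g` is one. -/
def Program.forEach (cols : List ℕ) (off g : ℕ) (body : Program L) : Program L :=
  .seq (.loop (.nonempty g) (.seq body (.instrs (shiftForth cols off))))
    (.loop (.nonempty (g + off)) (.instrs (shiftBack cols off)))

/-- The iteration restores all stacks but the one that the body works on. -/
theorem Runs.forEach [Finite U] {cols : List ℕ} {off g z n B : ℕ} {body : Program L} {s : Store U}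
    (hnd : cols.Nodup) (hlt : ∀ x ∈ cols, x < off) (hg : g ∈ cols)
    (hlen : ∀ x ∈ cols, (s x).length = n) (hg0 : s (g + off) = []) (hz : z ∉ cols)
    (hz' : ∀ x ∈ cols, z ≠ x + off) (P : ℕ → List (Cell U) → Prop) (h0 : P 0 (s z))
    (hbody : ∀ i < n, ∀ o, P i o → ∃ o', P (i + 1) o' ∧
      Runs A body (Function.update (zipper cols off i s) z o)
        (Function.update (zipper cols off i s) z o') B) :
    ∃ o', P n o' ∧ Runs A (.forEach cols off g body) s (Function.update s z o')
      (n * (B + 4 * cols.length + 6) + 2) := by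
  have hgz : g ≠ z := fun h => hz (h ▸ hg)
  have hgz' : g + off ≠ z := fun h => hz' g hg h.symm
  -- A row costs B for the body, 2 * |cols| + 2 for the shift and 1 for the test; on the way back
  -- again 2 * |cols| + 3. The two failing tests at the ends of the loops give the final 2.
  have forth : ∀ j i, i + j = n → ∀ o, P i o → ∃ o', P n o' ∧
      Runs A (.loop (.nonempty g) (.seq body (.instrs (shiftForth cols off))))
        (Function.update (zipper cols off i s) z o) (Function.update (zipper cols off n s) z o')
        (1 + j * (B + 2 * cols.length + 3)) := by
    intro j
    induction j with
    | zero =>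
      intro i hi o ho
      obtain rfl : i = n := by omega
      refine ⟨o, ho, (Runs.loop_neg ?_).mono (by simp)⟩
      simp [Test.Holds, hgz, zipper_of_mem hg, hlen g hg]
    | succ j ih =>
      intro i hi o ho
      obtain ⟨o1, ho1, h1⟩ := hbody i (by omega) o ho
      obtain ⟨o2, ho2, h2⟩ := ih (i + 1) (by omega) o1 ho1
      refine ⟨o2, ho2, ?_⟩
      have h3 := Runs.instrs (A := A) (shiftForth cols off)
        (Function.update (zipper cols off i s) z o1)
      change Runs A _ _ (Instr.run A _ _) _ at h3
      rw [← zipper_update _ hz hz', run_shiftForth_zipper hnd hlt, zipper_update _ hz hz',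
        zipper_update _ hz hz', length_shiftForth] at h3
      refine (Runs.loop_pos ?_ (h1.seq h3) h2).mono ?_
      · simp [Test.Holds, hgz, zipper_of_mem hg, hlen g hg]
        omega
      · linarith
  -- The auxiliary stack of `g` was empty initially, so it becomes empty exactly when all rows are
  -- back.
  have back : ∀ i ≤ n, ∀ o, Runs A (.loop (.nonempty (g + off)) (.instrs (shiftBack cols off)))
      (Function.update (zipper cols off i s) z o) (Function.update s z o)
      (1 + i * (2 * cols.length + 3)) := by
    intro i
    induction i with
    | zero =>
      intro _ o
      rw [zipper_zero]
      exact (Runs.loop_neg (by simp [Test.Holds, hgz', hg0])).mono (by simp)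
    | succ i ih =>
      intro hi o
      have h3 := Runs.instrs (A := A) (shiftBack cols off)
        (Function.update (zipper cols off (i + 1) s) z o)
      change Runs A _ _ (Instr.run A _ _) _ at h3
      rw [← zipper_update _ hz hz', run_shiftBack_zipper hnd hlt, zipper_update _ hz hz',
        zipper_update _ hz hz', length_shiftBack] at h3
      · refine (Runs.loop_pos ?_ h3 (ih (by omega) o)).mono ?_
        · have : 0 < (s g).length := by rw [hlen g hg]; omega
          simp [Test.Holds, hgz', zipper_add hg hlt, List.ne_nil_of_length_pos this]
        · linarith
      · intro x hx
        have hxz : x ≠ z := fun h => hz (h ▸ hx)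
        simp only [Function.update_of_ne hxz, hlen x hx]
        omega
  obtain ⟨o, ho, h⟩ := forth n 0 (by omega) (s z) h0
  rw [zipper_zero, Function.update_eq_self] at h
  exact ⟨o, ho, (h.seq (back n le_rfl o)).mono (by ring_nf; omega)⟩

end ForEach

/-! ## The learner

The learner uses the following stacks: `0` for input and output, `1 + i` for the `i`-th components
of the examples, `1 + k + j` for the possible values of the `j`-th parameter, `k + ℓ + 1` for the
labels, `k + ℓ + 2` for a flag that is raised when an example is misclassified,
`2 * (k + ℓ) + 4` for truth values, and the stacks from `2 * (k + ℓ) + 5` on as working space. An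
iteration over stack `y` moves the cells to stack `y + (k + ℓ + 2)` and back. -/

section Search

/-- The effect of a search among the elements of `G` on the output: an output that is already there
is kept; otherwise a good element is written on the output, if there is one. -/
def Found {α β : Type*} (good : α → Prop) (out : α → List β) (G : Set α) (o o' : List β) : Prop :=
  (o ≠ [] ∧ o' = o) ∨ (o = [] ∧ o' = [] ∧ ∀ h ∈ G, ¬ good h) ∨
    (o = [] ∧ ∃ h ∈ G, good h ∧ o' = out h)

variable {α β : Type*} {good : α → Prop} {out : α → List β}

lemma Found.empty (o : List β) : Found good out ∅ o o := by
  by_cases h : o = []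
  · exact Or.inr (Or.inl ⟨h, h, by simp⟩)
  · exact Or.inl ⟨h, rfl⟩

/-- Since `out h` is never empty, a success of the first search is visible to the second, which then
leaves the output alone. -/
lemma Found.union (hout : ∀ h, out h ≠ []) {G G' : Set α} {o o' o'' : List β}
    (h : Found good out G o o') (h' : Found good out G' o' o'') :
    Found good out (G ∪ G') o o'' := by
  rcases h with ⟨h1, rfl⟩ | ⟨rfl, rfl, h1⟩ | ⟨rfl, g, hg, h1, rfl⟩
  · rcases h' with ⟨-, rfl⟩ | ⟨h2, -⟩ | ⟨h2, -⟩
    · exact Or.inl ⟨h1, rfl⟩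
    · exact absurd h2 h1
    · exact absurd h2 h1
  · rcases h' with ⟨h2, -⟩ | ⟨-, rfl, h2⟩ | ⟨-, g, hg, h2, rfl⟩
    · exact absurd rfl h2
    · exact Or.inr (Or.inl ⟨rfl, rfl, fun g hg => hg.elim (h1 g) (h2 g)⟩)
    · exact Or.inr (Or.inr ⟨rfl, g, Or.inr hg, h2, rfl⟩)
  · rcases h' with ⟨-, rfl⟩ | ⟨h2, -⟩ | ⟨h2, -⟩
    · exact Or.inr (Or.inr ⟨rfl, g, Or.inl hg, h1, rfl⟩)
    · exact absurd h2 (hout g)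
    · exact absurd h2 (hout g)

end Search

/-- The stacks that hold the examples. -/
def exampleCols (k ℓ : ℕ) : List ℕ := (List.finRange k).map (fun i => 1 + i.val) ++ [k + ℓ + 1]

lemma mem_exampleCols {k ℓ y : ℕ} :
    y ∈ exampleCols k ℓ ↔ (1 ≤ y ∧ y ≤ k) ∨ y = k + ℓ + 1 := by
  simp only [exampleCols, List.mem_append, List.mem_map, List.mem_finRange, true_and,
    List.mem_singleton]
  refine or_congr_left ⟨?_, ?_⟩
  · rintro ⟨i, rfl⟩
    omega
  · rintro ⟨h1, h2⟩
    exact ⟨⟨y - 1, by omega⟩, by simp; omega⟩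

lemma nodup_exampleCols (k ℓ : ℕ) : (exampleCols k ℓ).Nodup := by
  refine List.Nodup.append ((List.nodup_finRange k).map fun i j h => ?_) (by simp) ?_
  · exact Fin.ext (by simpa using h)
  · intro y hy hy'
    simp only [List.mem_map, List.mem_finRange, true_and, List.mem_singleton] at hy hy'
    obtain ⟨i, rfl⟩ := hy
    omega

@[simp] lemma length_exampleCols (k ℓ : ℕ) : (exampleCols k ℓ).length = k + 1 := by
  simp [exampleCols]

lemma tupleCells_eq_map {U : Type w} {m : ℕ} (a : Fin m → U) :
    tupleCells a = (List.finRange m).map fun i => Cell.elt (a i) := by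
  simp [tupleCells, List.ofFn_eq_map]

/-! ### Checking one hypothesis, and nested loops over the parameters. -/

section Learner

variable {L : FirstOrder.Language.{u, v}} {U : Type w} [L.Structure U] {A : LocalAccess L U}
  {k ℓ : ℕ}

/-- The examples `T` are loaded and the working space is empty. -/
structure Loaded (k ℓ : ℕ) {U : Type w} (T : List ((Fin k → U) × Bool)) (s : Store U) : Prop where
  component : ∀ i : Fin k, s (1 + i) = T.map fun e => .elt (e.1 i)
  label : s (k + ℓ + 1) = T.map fun e => .bit e.2
  label_aux : s (2 * (k + ℓ) + 3) = []
  flag : s (k + ℓ + 2) = []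
  fresh : ∀ y, 2 * (k + ℓ) + 5 ≤ y → s y = []

/-- The flag is raised only when it is down, so a single `pop` clears it later. -/
def checkRow (ψ : Guarded L (k + ℓ)) : Program L :=
  .seq (ψ.program (fun i => 1 + i) (2 * (k + ℓ) + 5) (2 * (k + ℓ) + 4))
    (.ite (.same (2 * (k + ℓ) + 4) (k + ℓ + 1)) (.basic (.pop (2 * (k + ℓ) + 4)))
      (.seq (.basic (.pop (2 * (k + ℓ) + 4)))
        (.ite (.nonempty (k + ℓ + 2)) .skip (.basic (.push (k + ℓ + 2) true)))))

-- `p` stands for the statement that no earlier example was misclassified.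
open Classical in
lemma runs_checkRow [Finite U] {d : ℕ} (hd : maxDegree L U ≤ d) (ψ : Guarded L (k + ℓ))
    (s : Store U) (a : Fin (k + ℓ) → U) (c : Bool)
    (ha : ∀ i : Fin (k + ℓ), (s (1 + i)).head? = some (.elt (a i)))
    (hc : (s (k + ℓ + 1)).head? = some (.bit c)) (hs : ∀ y, 2 * (k + ℓ) + 5 ≤ y → s y = [])
    (p : Prop) (hp : s (k + ℓ + 2) = if p then [] else [.bit true]) :
    Runs A (checkRow ψ) s (Function.update s (k + ℓ + 2)
      (if p ∧ (ψ.Realize a ↔ c = true) then [] else [.bit true])) (ψ.steps d + 5) := by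
  have h1 := ψ.runs_program (A := A) hd (fun i => 1 + i) (2 * (k + ℓ) + 5) (2 * (k + ℓ) + 4) s a ha
    (fun i => by omega) (fun i => by omega) (by omega) hs
  have hpop := Runs.basic (A := A) (.pop (2 * (k + ℓ) + 4))
    (Function.update s (2 * (k + ℓ) + 4) (.bit (decide (ψ.Realize a)) :: s (2 * (k + ℓ) + 4)))
  simp only [Instr.apply, Function.update_self, List.tail_cons, Function.update_idem,
    Function.update_eq_self] at hpop
  have hne : k + ℓ + 1 ≠ 2 * (k + ℓ) + 4 := by omega
  have key : Test.Holds (L := L) (.same (2 * (k + ℓ) + 4) (k + ℓ + 1)) (Function.update s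
      (2 * (k + ℓ) + 4) (.bit (decide (ψ.Realize a)) :: s (2 * (k + ℓ) + 4))) ↔
      (ψ.Realize a ↔ c = true) := by
    simp only [Test.Holds, Function.update_self, Function.update_of_ne hne, hc]
    by_cases hψ : ψ.Realize a <;> cases c <;> simp [hψ]
  by_cases hψ : ψ.Realize a ↔ c = true
  · refine (Runs.mono (h1.seq (Runs.ite_pos (key.2 hψ) hpop)) (by omega)).congr_post ?_
    simp [hψ, ← hp]
  · have hψ' := fun h => hψ (key.1 h)
    by_cases hp' : p
    · refine (Runs.mono (h1.seq (Runs.ite_neg hψ' (hpop.seq (Runs.ite_neg ?_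
        (Runs.basic (.push (k + ℓ + 2) true) s))))) (by omega)).congr_post ?_
      · simp [Test.Holds, hp, hp']
      · simp [Instr.apply, hψ, hp, hp']
    · refine (Runs.mono (h1.seq (Runs.ite_neg hψ' (hpop.seq (Runs.ite_pos ?_
        (Runs.skip s))))) (by omega)).congr_post ?_
      · simp [Test.Holds, hp, hp']
      · funext y
        by_cases hy : y = k + ℓ + 2
        · subst hy; simp [hp, hp']
        · simp [hy]

def check (ψ : Guarded L (k + ℓ)) : Program L :=
  .forEach (exampleCols k ℓ) (k + ℓ + 2) (k + ℓ + 1) (checkRow ψ)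

open Classical in
lemma runs_check [Finite U] {d : ℕ} (hd : maxDegree L U ≤ d) (ψ : Guarded L (k + ℓ))
    {T : List ((Fin k → U) × Bool)} {s : Store U} (hs : Loaded k ℓ T s) (ws : Fin ℓ → U)
    (hws : ∀ j : Fin ℓ, (s (1 + k + j)).head? = some (.elt (ws j))) :
    Runs A (check ψ) s (Function.update s (k + ℓ + 2)
      (if ∀ e ∈ T, ψ.Realize (Fin.append e.1 ws) ↔ e.2 = true then [] else [.bit true]))
      (T.length * (ψ.steps d + 4 * k + 15) + 2) := by
  obtain ⟨o, rfl, h⟩ := Runs.forEach (A := A) (B := ψ.steps d + 5) (body := checkRow ψ)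
    (off := k + ℓ + 2)
    (g := k + ℓ + 1) (z := k + ℓ + 2) (n := T.length) (s := s) (nodup_exampleCols k ℓ)
    (fun x hx => by rw [mem_exampleCols] at hx; omega) (by rw [mem_exampleCols]; omega)
    (fun x hx => by
      rcases mem_exampleCols.1 hx with ⟨h1, h2⟩ | rfl
      · obtain ⟨i, rfl⟩ : ∃ i : Fin k, x = 1 + i := ⟨⟨x - 1, by omega⟩, by simp; omega⟩
        simp [hs.component]
      · simp [hs.label])
    (by rw [← hs.label_aux]; congr 1; omega)
    (by rw [mem_exampleCols]; omega) (fun x hx => by rw [mem_exampleCols] at hx; omega)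
    -- Invariant: the flag is down exactly if the first `i` examples are classified correctly.
    (fun i o => o = if ∀ e ∈ T.take i, ψ.Realize (Fin.append e.1 ws) ↔ e.2 = true
      then [] else [.bit true]) (by simp [hs.flag])
    (by
      rintro i hi o rfl
      refine ⟨_, rfl, ?_⟩
      refine (runs_checkRow (A := A) hd ψ (Function.update
        (zipper (exampleCols k ℓ) (k + ℓ + 2) i s) (k + ℓ + 2) (if ∀ e ∈ T.take i, ψ.Realize (Fin.append e.1 ws) ↔ e.2 = true
        then [] else [.bit true])) (Fin.append (T[i]).1 ws) (T[i]).2 ?_ ?_ ?_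
        (∀ e ∈ T.take i, ψ.Realize (Fin.append e.1 ws) ↔ e.2 = true)
        (by rw [Function.update_self]; congr)).congr_post ?_
      · intro j
        refine Fin.addCases (fun j => ?_) (fun j => ?_) j
        · have h1 : 1 + j.val ∈ exampleCols k ℓ := by rw [mem_exampleCols]; omega
          have h2 : 1 + j.val ≠ k + ℓ + 2 := by omega
          simp [h2, zipper_of_mem h1, hs.component, hi]
        · have h1 : 1 + (k + j.val) ∉ exampleCols k ℓ := by rw [mem_exampleCols]; omega
          have h2 : 1 + (k + j.val) ≠ k + ℓ + 2 := by omega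
          have h3 : ∀ x ∈ exampleCols k ℓ, 1 + (k + j.val) ≠ x + (k + ℓ + 2) := fun x _ => by omega
          simp only [Fin.val_natAdd, Function.update_of_ne h2, zipper_of_notMem h1 h3,
            Fin.append_right]
          rw [← add_assoc, hws]
      · have h1 : k + ℓ + 1 ∈ exampleCols k ℓ := by rw [mem_exampleCols]; omega
        have h2 : k + ℓ + 1 ≠ k + ℓ + 2 := by omega
        simp [zipper_of_mem h1, hs.label, hi]
      · intro y hy
        have h1 : y ∉ exampleCols k ℓ := by rw [mem_exampleCols]; omega
        have h2 : y ≠ k + ℓ + 2 := by omega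
        have h3 : ∀ x ∈ exampleCols k ℓ, y ≠ x + (k + ℓ + 2) := fun x hx => by
          rw [mem_exampleCols] at hx; omega
        simp [h2, zipper_of_notMem h1 h3, hs.fresh y hy]
      · rw [Function.update_idem]
        congr 2
        rw [List.take_succ_eq_append_getElem hi]
        simp only [List.mem_append, List.mem_singleton, eq_iff_iff]
        constructor
        · rintro ⟨h1, h2⟩ e (he | rfl)
          · exact h1 e he
          · exact h2
        · exact fun h => ⟨fun e he => h e (Or.inl he), h _ (Or.inr rfl)⟩)
  refine (h.mono ?_).congr_post ?_
  · rw [length_exampleCols]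
    exact le_of_eq (by ring)
  · simp

/-- Write a positive outcome, with the formula given by a bit string. -/
def emit (k ℓ : ℕ) (bits : List Bool) : List Instr :=
  ((List.finRange ℓ).reverse.map fun j => .copy (1 + k + j) 0) ++
    (true :: bits).reverse.map (.push 0)

lemma run_emit (bits : List Bool) (s : Store U) (ws : Fin ℓ → U)
    (hws : ∀ j : Fin ℓ, (s (1 + k + j)).head? = some (.elt (ws j))) :
    Instr.run A (emit k ℓ bits) s =
      Function.update s 0 (.bit true :: (bits.map .bit ++ tupleCells ws) ++ s 0) := by
  have h := Instr.run_copy_tops (A := A) ((List.finRange ℓ).reverse.map fun j =>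
    ((1 + k + j.val, .elt (ws j)) : ℕ × Cell U)) 0 s (by
      intro p hp
      simp only [List.mem_map, List.mem_reverse, List.mem_finRange, true_and] at hp
      obtain ⟨j, rfl⟩ := hp
      exact ⟨by omega, hws j⟩)
  simp only [List.map_map, Function.comp_def] at h
  rw [emit, Instr.run_append, Instr.run_push_bits, h]
  simp [tupleCells_eq_map, ← List.map_reverse]

/-- Check a hypothesis, unless there is an output already. -/
def tryOut (bits : Guarded L (k + ℓ) → List Bool) (ψ : Guarded L (k + ℓ)) : Program L :=
  .ite (.nonempty 0) .skip (.seq (check ψ)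
    (.ite (.nonempty (k + ℓ + 2)) (.basic (.pop (k + ℓ + 2))) (.instrs (emit k ℓ (bits ψ)))))

def tryOutSteps (bits : Guarded L (k + ℓ) → List Bool) (ψ : Guarded L (k + ℓ)) (d t : ℕ) : ℕ :=
  t * (ψ.steps d + 4 * k + 15) + (ℓ + (bits ψ).length + 7)

/-- A hypothesis, given by a guarded formula and parameters, is consistent with `T`. -/
def Fits (T : List ((Fin k → U) × Bool)) (h : Guarded L (k + ℓ) × (Fin ℓ → U)) : Prop :=
  ∀ e ∈ T, h.1.Realize (Fin.append e.1 h.2) ↔ e.2 = true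

/-- The cells that represent a hypothesis as outcome. -/
def fitCells (bits : Guarded L (k + ℓ) → List Bool) (h : Guarded L (k + ℓ) × (Fin ℓ → U)) :
    List (Cell U) :=
  .bit true :: ((bits h.1).map .bit ++ tupleCells h.2)

lemma runs_tryOut [Finite U] {d : ℕ} (hd : maxDegree L U ≤ d)
    (bits : Guarded L (k + ℓ) → List Bool) (ψ : Guarded L (k + ℓ))
    {T : List ((Fin k → U) × Bool)} {s : Store U} (hs : Loaded k ℓ T s) (ws : Fin ℓ → U)
    (hws : ∀ j : Fin ℓ, (s (1 + k + j)).head? = some (.elt (ws j))) :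
    ∃ o, Found (Fits T) (fitCells bits) {(ψ, ws)} (s 0) o ∧
      Runs A (tryOut bits ψ) s (Function.update s 0 o) (tryOutSteps bits ψ d T.length) := by
  classical
  by_cases h0 : s 0 = []
  · have hcheck := runs_check (A := A) hd ψ hs ws hws
    have hne : ¬ Test.Holds (L := L) (.nonempty 0) s := by simp [Test.Holds, h0]
    by_cases hfit : ∀ e ∈ T, ψ.Realize (Fin.append e.1 ws) ↔ e.2 = true
    · rw [if_pos hfit, ← hs.flag, Function.update_eq_self] at hcheck
      refine ⟨fitCells bits (ψ, ws), Or.inr (Or.inr ⟨h0, (ψ, ws), rfl, hfit, rfl⟩), ?_⟩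
      have h := Runs.instrs (A := A) (emit k ℓ (bits ψ)) s
      change Runs A _ _ (Instr.run A _ _) _ at h
      rw [run_emit (bits ψ) s ws hws, h0, List.append_nil] at h
      refine (Runs.ite_neg hne (hcheck.seq (Runs.ite_neg ?_ h))).mono ?_
      · simp [Test.Holds, hs.flag]
      · simp [tryOutSteps, emit]
        omega
    · rw [if_neg hfit] at hcheck
      refine ⟨[], Or.inr (Or.inl ⟨h0, rfl, ?_⟩), ?_⟩
      · rintro _ rfl
        exact hfit
      · rw [← h0, Function.update_eq_self]
        refine (Runs.mono (Runs.ite_neg hne (hcheck.seq (Runs.ite_pos ?_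
          (Runs.basic (.pop (k + ℓ + 2)) _)))) ?_).congr_post ?_
        · simp [Test.Holds]
        · simp only [tryOutSteps]
          omega
        · simp [Instr.apply, ← hs.flag]
  · refine ⟨s 0, Or.inl ⟨h0, rfl⟩, ?_⟩
    rw [Function.update_eq_self]
    refine (Runs.ite_pos ?_ (Runs.skip s)).mono ?_
    · simpa [Test.Holds] using h0
    · simp only [tryOutSteps]; omega

/-- Execute `body` for all values of the given parameters. -/
def overParams (k ℓ : ℕ) : List (Fin ℓ) → Program L → Program L
  | [], body => body
  | j :: js, body =>
    .forEach [1 + k + j] (k + ℓ + 2) (1 + k + j) (overParams k ℓ js body)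

/-- The constants are those of `Runs.forEach` with one column: 4 * 1 + 6 per row and 2 at the end.
For a fixed number of loops the value is polynomial in n and B. -/
def overParamsSteps (n B : ℕ) : ℕ → ℕ
  | 0 => B
  | m + 1 => n * (overParamsSteps n B m + 10) + 2

/-- The current value of a parameter is the top of its stack. `js` lists the loops still to be
entered; the other parameters are fixed by the outer loops. These loops shift cells between
parameter stacks and auxiliary stacks, so the body may rely on `base` only elsewhere. -/
lemma runs_overParams [Finite U] {α : Type*} {good : α → Prop} {out : α → List (Cell U)}
    (hout : ∀ h, out h ≠ []) (f : (Fin ℓ → U) → α) {body : Program L} {B : ℕ}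
    (base : Store U) (X : List U)
    (hbody : ∀ s : Store U, (∀ y, y ≠ 0 → (∀ j : Fin ℓ, y ≠ 1 + k + j ∧
        y ≠ 1 + k + j + (k + ℓ + 2)) → s y = base y) →
      ∀ ws : Fin ℓ → U, (∀ j : Fin ℓ, (s (1 + k + j)).head? = some (.elt (ws j))) →
      ∃ o, Found good out {f ws} (s 0) o ∧ Runs A body s (Function.update s 0 o) B)
    (js : List (Fin ℓ)) (hjs : js.Nodup) (s : Store U)
    (hs : ∀ y, y ≠ 0 → (∀ j : Fin ℓ, y ≠ 1 + k + j ∧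
        y ≠ 1 + k + j + (k + ℓ + 2)) → s y = base y)
    (hdone : ∀ j ∉ js, ∃ a, (s (1 + k + j.val)).head? = some (.elt a))
    (htodo : ∀ j ∈ js, s (1 + k + j.val) = X.map .elt ∧ s (1 + k + j.val + (k + ℓ + 2)) = []) :
    ∃ o, Found good out (f '' {ws | (∀ j ∉ js, (s (1 + k + j.val)).head? = some (.elt (ws j))) ∧
        ∀ j ∈ js, ws j ∈ X}) (s 0) o ∧
      Runs A (overParams k ℓ js body) s (Function.update s 0 o)
        (overParamsSteps X.length B js.length) := by
  induction js generalizing s with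
  | nil =>
    choose ws hws using fun j => hdone j (by simp)
    obtain ⟨o, ho, h⟩ := hbody s hs ws hws
    refine ⟨o, ?_, h⟩
    convert ho using 1
    ext a
    simp only [List.not_mem_nil, not_false_eq_true, forall_const, Set.mem_image, Set.mem_ofPred_eq,
      IsEmpty.forall_iff, implies_true, and_true, Set.mem_singleton_iff]
    constructor
    · rintro ⟨ws', h, rfl⟩
      congr 1
      funext j
      simpa [hws j] using (h j).symm
    · rintro rfl
      exact ⟨ws, hws, rfl⟩
  | cons j js ih =>
    simp only [List.nodup_cons] at hjs
    obtain ⟨hX, haux⟩ := htodo j (by simp)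
    have hmem : ∀ {x : ℕ}, x ∈ [1 + k + j.val] ↔ x = 1 + k + j.val := by simp
    -- Assignments that agree with the outer loops and whose j-th value is among the values `Y`
    -- already treated.
    let G : List U → Set (Fin ℓ → U) := fun Y =>
      {ws | (∀ i ∉ j :: js, (s (1 + k + i.val)).head? = some (.elt (ws i))) ∧ ws j ∈ Y ∧
        ∀ i ∈ js, ws i ∈ X}
    obtain ⟨o, ho, h⟩ := Runs.forEach (A := A) (cols := [1 + k + j.val]) (off := k + ℓ + 2)
      (g := 1 + k + j.val) (z := 0) (n := X.length) (B := overParamsSteps X.length B js.length)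
      (body := overParams k ℓ js body) (s := s) (by simp)
      (fun x hx => by rw [hmem] at hx; omega) (by simp)
      (fun x hx => by rw [hmem] at hx; simp [hx, hX]) haux (by simp; omega)
      (fun x hx => by omega)
      (fun i o => Found good out (f '' G (X.take i)) (s 0) o)
      (by
        have : G (X.take 0) = ∅ := by
          ext ws; simp [G]
        rw [this, Set.image_empty]
        exact Found.empty _)
      (by
        intro i hi o ho
        have e : ∀ y, y ≠ 0 → y ≠ 1 + k + j.val → y ≠ 1 + k + j.val + (k + ℓ + 2) →
            Function.update (zipper [1 + k + j.val] (k + ℓ + 2) i s) 0 o y = s y := by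
          intro y h1 h2 h3
          rw [Function.update_of_ne h1, zipper_of_notMem (by simpa using h2)]
          rintro x hx rfl
          rw [hmem] at hx
          exact h3 (by rw [hx])
        have etop : Function.update (zipper [1 + k + j.val] (k + ℓ + 2) i s) 0 o (1 + k + j.val) =
            (X.drop i).map .elt := by
          rw [Function.update_of_ne (by omega), zipper_of_mem (by simp), hX, List.map_drop]
        obtain ⟨o', ho', h'⟩ := ih hjs.2 (Function.update (zipper [1 + k + j.val] (k + ℓ + 2) i s) 0 o)
          (fun y hy hy' => by rw [e y hy (hy' j).1 (hy' j).2, hs y hy hy'])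
          (fun i' hi' => by
            by_cases hij : i' = j
            · subst hij
              rw [etop]
              exact ⟨X[i], by simp [hi]⟩
            · have : i'.val ≠ j.val := fun h => hij (Fin.ext h)
              rw [e _ (by omega) (by omega) (by omega)]
              exact hdone i' (by simp [hij, hi']))
          (fun i' hi' => by
            have hij : i' ≠ j := fun h => hjs.1 (h ▸ hi')
            have : i'.val ≠ j.val := fun h => hij (Fin.ext h)
            rw [e _ (by omega) (by omega) (by omega), e _ (by omega) (by omega) (by omega)]
            exact htodo i' (by simp [hi']))
        rw [Function.update_self, Function.update_idem] at *
        refine ⟨o', ?_, h'⟩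
        convert ho.union hout ho' using 1
        rw [← Set.image_union]
        congr 1
        ext ws
        rw [List.take_succ_eq_append_getElem hi]
        -- In the inner call parameter `j` counts as fixed, with value `X[i]`.
        have key : (∀ i' ∉ js, (Function.update (zipper [1 + k + j.val] (k + ℓ + 2) i s) 0 o
            (1 + k + i'.val)).head? = some (.elt (ws i'))) ↔ ws j = X[i] ∧
            ∀ i' ∉ j :: js, (s (1 + k + i'.val)).head? = some (.elt (ws i')) := by
          have e1 : ∀ i', i' ≠ j → Function.update (zipper [1 + k + j.val] (k + ℓ + 2) i s) 0 o
              (1 + k + i'.val) = s (1 + k + i'.val) := fun i' hij => by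
            have : i'.val ≠ j.val := fun h => hij (Fin.ext h)
            exact e _ (by omega) (by omega) (by omega)
          constructor
          · intro h
            refine ⟨?_, fun i' hi' => ?_⟩
            · have := h j hjs.1
              rw [etop] at this
              simpa [hi, eq_comm] using this
            · simp only [List.mem_cons, not_or] at hi'
              rw [← e1 i' hi'.1]
              exact h i' hi'.2
          · rintro ⟨h1, h2⟩ i' hi'
            by_cases hij : i' = j
            · subst hij
              rw [etop]
              simp [hi, h1]
            · rw [e1 i' hij]
              exact h2 i' (by simp [hij, hi'])
        simp only [G, Set.mem_ofPred_eq, Set.mem_union, List.mem_append, List.mem_singleton, key]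
        tauto)
    refine ⟨o, ?_, h⟩
    convert ho using 2
    ext ws
    simp [G]

end Learner

/-! ### Loading the examples, computing the balls around them, and the complete search. -/

section Preparation

variable {L : FirstOrder.Language.{u, v}} {U : Type w} [L.Structure U] {A : LocalAccess L U}
  {k ℓ : ℕ}

/-- Load one example, and write its elements on the first stack of the working space. -/
def loadRow (k ℓ : ℕ) : List Instr :=
  deal (exampleCols k ℓ) ++ (List.finRange k).map fun i => .copy (1 + i) (2 * (k + ℓ) + 5)

lemma length_loadRow (k ℓ : ℕ) : (loadRow k ℓ).length = 3 * k + 2 := by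
  simp [loadRow, length_deal]
  omega

lemma run_loadRow (e : (Fin k → U) × Bool) (rest : List (Cell U)) (s : Store U)
    (hs : s 0 = tupleCells e.1 ++ [.bit e.2] ++ rest) :
    Instr.run A (loadRow k ℓ) s 0 = rest ∧
      (∀ i : Fin k, Instr.run A (loadRow k ℓ) s (1 + i) = .elt (e.1 i) :: s (1 + i)) ∧
      Instr.run A (loadRow k ℓ) s (k + ℓ + 1) = .bit e.2 :: s (k + ℓ + 1) ∧
      Instr.run A (loadRow k ℓ) s (2 * (k + ℓ) + 5) =
        (List.ofFn e.1).reverse.map .elt ++ s (2 * (k + ℓ) + 5) ∧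
      ∀ y ≠ 0, y ∉ exampleCols k ℓ → y ≠ 2 * (k + ℓ) + 5 →
        Instr.run A (loadRow k ℓ) s y = s y := by
  let l : List (ℕ × Cell U) := (List.finRange k).map (fun i => (1 + i.val, .elt (e.1 i))) ++
    [(k + ℓ + 1, .bit e.2)]
  have hfst : l.map Prod.fst = exampleCols k ℓ := by simp [l, exampleCols]
  have hsnd : l.map Prod.snd = tupleCells e.1 ++ [.bit e.2] := by
    simp [l, tupleCells_eq_map]
  obtain ⟨h1, h2, h3⟩ := Instr.run_deal (A := A) l (hfst ▸ nodup_exampleCols k ℓ)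
    (by rw [hfst, mem_exampleCols]; omega) rest s (by rw [hsnd, hs])
  rw [hfst] at h1 h2 h3
  have hel : ∀ i : Fin k, Instr.run A (deal (exampleCols k ℓ)) s (1 + i) =
      .elt (e.1 i) :: s (1 + i) := fun i => h2 (1 + i.val, .elt (e.1 i))
    (List.mem_append_left _ (List.mem_map.2 ⟨i, List.mem_finRange i, rfl⟩))
  have hf : 2 * (k + ℓ) + 5 ∉ exampleCols k ℓ := by rw [mem_exampleCols]; omega
  have h4 := Instr.run_copy_tops (A := A) ((List.finRange k).map fun i =>
    ((1 + i.val, .elt (e.1 i)) : ℕ × Cell U)) (2 * (k + ℓ) + 5)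
    (Instr.run A (deal (exampleCols k ℓ)) s) (by
      intro p hp
      simp only [List.mem_map, List.mem_finRange, true_and] at hp
      obtain ⟨i, rfl⟩ := hp
      exact ⟨by simp only; omega, by simp [hel]⟩)
  simp only [List.map_map, Function.comp_def] at h4
  have hrow : Instr.run A (loadRow k ℓ) s = Function.update (Instr.run A (deal (exampleCols k ℓ)) s)
      (2 * (k + ℓ) + 5) ((List.ofFn e.1).reverse.map .elt ++ s (2 * (k + ℓ) + 5)) := by
    rw [loadRow, Instr.run_append, h4, h3 _ (by omega) hf]
    simp [List.ofFn_eq_map, Function.comp_def]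
  rw [hrow]
  refine ⟨?_, fun i => ?_, ?_, ?_, fun y hy hy' hy2 => ?_⟩
  · rw [Function.update_of_ne (by omega), h1]
  · rw [Function.update_of_ne (by omega), hel]
  · rw [Function.update_of_ne (by omega), h2 (k + ℓ + 1, .bit e.2) (by simp [l])]
  · rw [Function.update_self]
  · rw [Function.update_of_ne hy2, h3 y hy hy']

def load (k ℓ : ℕ) : Program L := .loop (.nonempty 0) (.instrs (loadRow k ℓ))

/-- Pushing reverses the order of the examples, which is harmless for consistency. `E` lists, with
repetitions, the elements around which balls are computed. -/
lemma runs_load [Finite U] (T : List ((Fin k → U) × Bool)) (s : Store U)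
    (hs : s 0 = trainingCells T) :
    ∃ (s' : Store U) (E : List U), Runs A (load k ℓ) s s' (1 + T.length * (3 * k + 5)) ∧
      s' 0 = [] ∧ (∀ i : Fin k, s' (1 + i) = (T.reverse.map fun e => .elt (e.1 i)) ++ s (1 + i)) ∧
      s' (k + ℓ + 1) = (T.reverse.map fun e => .bit e.2) ++ s (k + ℓ + 1) ∧
      s' (2 * (k + ℓ) + 5) = E.map .elt ++ s (2 * (k + ℓ) + 5) ∧
      (∀ e ∈ T, ∀ i, e.1 i ∈ E) ∧ E.length = T.length * k ∧
      ∀ y ≠ 0, y ∉ exampleCols k ℓ → y ≠ 2 * (k + ℓ) + 5 → s' y = s y := by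
  induction T generalizing s with
  | nil =>
    refine ⟨s, [], (Runs.loop_neg ?_).mono (by simp), ?_⟩
    · simp [Test.Holds, hs, trainingCells]
    · simp [hs, trainingCells]
  | cons e T ih =>
    have hs' : s 0 = tupleCells e.1 ++ [.bit e.2] ++ trainingCells T := by
      rw [hs]; simp [trainingCells]
    obtain ⟨h1, h2, h3, h4, h5⟩ := run_loadRow (A := A) (ℓ := ℓ) e _ s hs'
    obtain ⟨s', E, r0, r1, r2, r3, r4, r5, r6, r7⟩ := ih _ h1
    refine ⟨s', E ++ (List.ofFn e.1).reverse, ?_, r1, fun i => ?_, ?_, ?_, ?_, ?_, ?_⟩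
    · have h := Runs.instrs (A := A) (loadRow k ℓ) s
      rw [length_loadRow] at h
      refine (Runs.loop_pos ?_ h r0).mono ?_
      · simp [Test.Holds, hs']
      · simp only [List.length_cons]; linarith
    · rw [r2, h2]; simp
    · rw [r3, h3]; simp
    · rw [r4, h4]; simp
    · intro e' he' i
      rcases List.mem_cons.1 he' with rfl | he'
      · simp
      · exact List.mem_append_left _ (r5 e' he' i)
    · simp [r6, add_mul]
    · intro y hy hy' hy2
      rw [r7 y hy hy' hy2, h5 y hy hy' hy2]

/-- Add all neighbours to the elements on stack `a`; the result is on the next stack. -/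
def expand (a : ℕ) : Program L :=
  .loop (.nonempty a) (.instrs [.copy a (a + 1), .nbr a (a + 1), .pop a])

/-- Each element is copied along with its neighbours, so that iteration yields balls and not
spheres. Repetitions are kept; each element contributes at most d + 1 entries. -/
lemma runs_expand [Finite U] {d : ℕ} (hd : maxDegree L U ≤ d) (a : ℕ) (X Y : List U)
    (s : Store U) (hX : s a = X.map .elt) (hY : s (a + 1) = Y.map .elt) :
    ∃ X' : List U, Runs A (expand a) s
        (Function.update (Function.update s a []) (a + 1) (X'.map .elt)) (1 + X.length * 6) ∧
      Y ⊆ X' ∧ (∀ x ∈ X, x ∈ X' ∧ ∀ z, (gaifmanGraph L U).Adj x z → z ∈ X') ∧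
      X'.length ≤ Y.length + X.length * (d + 1) := by
  induction X generalizing s Y with
  | nil =>
    refine ⟨Y, (Runs.mono (Runs.loop_neg ?_) (by simp)).congr_post ?_, by simp, by simp, by simp⟩
    · simp [Test.Holds, hX]
    · rw [← hY, ← show s a = [] from hX, Function.update_eq_self, Function.update_eq_self]
  | cons x X ih =>
    have e : Instr.run A [.copy a (a + 1), .nbr a (a + 1), .pop a] s =
        Function.update (Function.update s (a + 1) ((A.nbrs x ++ x :: Y).map .elt)) a
          (X.map .elt) := by
      simp [Instr.apply, hX, hY]
    have h := Runs.instrs (A := A) [.copy a (a + 1), .nbr a (a + 1), .pop a] s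
    change Runs A _ _ (Instr.run A _ _) _ at h
    rw [e] at h
    obtain ⟨X', r1, r2, r3, r4⟩ := ih (A.nbrs x ++ x :: Y) (Function.update (Function.update s
      (a + 1) ((A.nbrs x ++ x :: Y).map .elt)) a (X.map .elt)) (by simp) (by simp)
    refine ⟨X', (Runs.mono (Runs.loop_pos ?_ h r1) ?_).congr_post ?_, ?_, ?_, ?_⟩
    · simp [Test.Holds, hX]
    · simp only [List.length_cons, List.length_nil]; omega
    · funext y
      by_cases hy : y = a + 1
      · subst hy; simp
      · by_cases hy' : y = a
        · subst hy'; simp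
        · simp [hy, hy']
    · exact fun y hy => r2 (by simp [hy])
    · intro x' hx'
      rcases List.mem_cons.1 hx' with rfl | hx'
      · exact ⟨r2 (by simp), fun z hz => r2 (by simp [A.mem_nbrs, hz])⟩
      · exact r3 x' hx'
    · have := (A.length_nbrs_le x).trans hd
      simp only [List.length_append, List.length_cons] at r4 ⊢
      linarith

def expandTimes (a : ℕ) : ℕ → Program L
  | 0 => .skip
  | n + 1 => .seq (expandTimes a n) (expand (a + n))

def expandSteps (x d : ℕ) : ℕ → ℕ
  | 0 => 2
  | n + 1 => expandSteps x d n + (1 + x * (d + 1) ^ n * 6)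

lemma runs_expandTimes [Finite U] {d : ℕ} (hd : maxDegree L U ≤ d) (a n : ℕ) (X : List U)
    (s : Store U) (hX : s a = X.map .elt) (hs : ∀ y, a < y → s y = []) :
    ∃ X' : List U, Runs A (expandTimes a n) s
        (Function.update (Function.update s a []) (a + n) (X'.map .elt))
        (expandSteps X.length d n) ∧
      (∀ x ∈ X, ∀ z, Near (gaifmanGraph L U) n x z → z ∈ X') ∧
      X'.length ≤ X.length * (d + 1) ^ n := by
  induction n with
  | zero =>
    refine ⟨X, (Runs.skip s).congr_post ?_, ?_, by simp⟩
    · simp [← hX]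
    · rintro x hx z rfl
      exact hx
  | succ n ih =>
    obtain ⟨X', h1, h2, h3⟩ := ih
    obtain ⟨X2, r1, -, r3, r4⟩ := runs_expand (A := A) hd (a + n) X' []
      (Function.update (Function.update s a []) (a + n) (X'.map .elt)) (by simp) (by
        have h1 : a + n + 1 ≠ a := by omega
        simp [h1, hs (a + n + 1) (by omega)])
    refine ⟨X2, (Runs.mono (h1.seq r1) ?_).congr_post ?_, ?_, ?_⟩
    · simp only [expandSteps]
      have := Nat.mul_le_mul_right 6 h3
      omega
    · funext y
      rw [← add_assoc]
      by_cases hy : y = a + n + 1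
      · subst hy; simp
      · by_cases hy' : y = a + n
        · subst hy'
          by_cases hn : n = 0
          · subst hn; simp
          · have : a + n ≠ a := by omega
            have h2 : a + n ≠ a + n + 1 := by omega
            rw [Function.update_of_ne h2, Function.update_self, Function.update_of_ne h2,
              Function.update_of_ne this, hs (a + n) (by omega)]
        · simp [hy, hy']
    · rintro x hx z ⟨c, hc, h⟩
      have hc' := r3 c (h2 x hx c hc)
      rcases h with rfl | h
      · exact hc'.1
      · exact hc'.2 z h
    · refine r4.trans ?_
      have := Nat.mul_le_mul_right (d + 1) h3
      rw [pow_succ]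
      simp only [List.length_nil, zero_add]
      linarith

/-- The stacks that hold the possible values of the parameters. -/
def paramCols (k ℓ : ℕ) : List ℕ := (List.finRange ℓ).map fun j => 1 + k + j.val

lemma mem_paramCols {k ℓ y : ℕ} : y ∈ paramCols k ℓ ↔ 1 + k ≤ y ∧ y < 1 + k + ℓ := by
  simp only [paramCols, List.mem_map, List.mem_finRange, true_and]
  constructor
  · rintro ⟨j, rfl⟩
    omega
  · rintro ⟨h1, h2⟩
    exact ⟨⟨y - (1 + k), by omega⟩, by simp; omega⟩

lemma nodup_paramCols (k ℓ : ℕ) : (paramCols k ℓ).Nodup :=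
  (List.nodup_finRange ℓ).map fun i j h => Fin.ext (by simpa using h)

/-- Copy the contents of stack `a` to all stacks for parameters. -/
def distribute (k ℓ a : ℕ) : Program L :=
  .loop (.nonempty a) (.instrs ((paramCols k ℓ).map (.copy a) ++ [.pop a]))

lemma runs_distribute [Finite U] (a : ℕ) (ha : a ∉ paramCols k ℓ) (X : List U)
    (s : Store U) (hX : s a = X.map .elt) :
    Runs A (distribute k ℓ a) s (fun y => if y = a then [] else if y ∈ paramCols k ℓ then
      X.reverse.map .elt ++ s y else s y) (1 + X.length * (ℓ + 4)) := by
  induction X generalizing s with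
  | nil =>
    refine (Runs.mono (Runs.loop_neg ?_) (by simp)).congr_post ?_
    · simp [Test.Holds, hX]
    · funext y
      by_cases hy : y = a
      · subst hy; simp [hX]
      · simp [hy]
  | cons x X ih =>
    have h := Runs.instrs (A := A) ((paramCols k ℓ).map (.copy a) ++ [.pop a]) s
    change Runs A _ _ (Instr.run A _ _) _ at h
    have h2 := Instr.run_copy_to (A := A) (paramCols k ℓ) (nodup_paramCols k ℓ) a ha (.elt x) s
      (by simp [hX])
    rw [Instr.run_append] at h
    rw [show (Instr.copy a) = fun y => Instr.copy a y from rfl, h2] at h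
    refine (Runs.mono (Runs.loop_pos ?_ h (ih _ ?_)) ?_).congr_post ?_
    · simp [Test.Holds, hX]
    · simp [Instr.apply, ha, hX]
    · simp only [List.length_cons, List.length_append, List.length_map, List.length_nil,
        paramCols, List.length_finRange]
      linarith
    · funext y
      by_cases hy : y = a
      · subst hy; simp
      · by_cases hy' : y ∈ paramCols k ℓ <;> simp [hy, hy', Instr.apply]

/-- Load the examples and compute the possible parameters: the elements at distance at most `n`
from an example. -/
def prepare (k ℓ n : ℕ) : Program L :=
  .seq (load k ℓ) (.seq (expandTimes (2 * (k + ℓ) + 5) n) (distribute k ℓ (2 * (k + ℓ) + 5 + n)))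

def prepareSteps (k ℓ n d t : ℕ) : ℕ :=
  1 + t * (3 * k + 5) + (expandSteps (t * k) d n + (1 + t * k * (d + 1) ^ n * (ℓ + 4)))

lemma runs_prepare [Finite U] {d : ℕ} (hd : maxDegree L U ≤ d) (n : ℕ)
    (T : List ((Fin k → U) × Bool)) :
    ∃ (s : Store U) (X : List U),
      Runs A (prepare k ℓ n) (Function.update (fun _ => []) 0 (trainingCells T)) s
        (prepareSteps k ℓ n d T.length) ∧
      s 0 = [] ∧ Loaded k ℓ T.reverse s ∧
      (∀ j : Fin ℓ, s (1 + k + j) = X.map .elt ∧ s (1 + k + j + (k + ℓ + 2)) = []) ∧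
      (∀ e ∈ T, ∀ i z, Near (gaifmanGraph L U) n (e.1 i) z → z ∈ X) ∧
      X.length ≤ T.length * k * (d + 1) ^ n := by
  obtain ⟨s1, E, h0, h1, h2, h3, h4, h5, h6, h7⟩ := runs_load (A := A) (ℓ := ℓ) T
    (Function.update (fun _ => []) 0 (trainingCells T)) (by simp)
  have h7' : ∀ y ≠ 0, y ∉ exampleCols k ℓ → y ≠ 2 * (k + ℓ) + 5 → s1 y = [] := by
    intro y hy hy1 hy2
    rw [h7 y hy hy1 hy2]
    simp [hy]
  obtain ⟨X, r1, r2, r3⟩ := runs_expandTimes (A := A) hd (2 * (k + ℓ) + 5) n E s1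
    (by rw [h4]; simp) (fun y hy => h7' y (by omega) (by rw [mem_exampleCols]; omega) (by omega))
  set s2 := Function.update (Function.update s1 (2 * (k + ℓ) + 5) []) (2 * (k + ℓ) + 5 + n)
    (X.map .elt) with hs2
  have hs2' : ∀ y, y < 2 * (k + ℓ) + 5 → s2 y = s1 y := by
    intro y hy
    rw [hs2, Function.update_of_ne (by omega), Function.update_of_ne (by omega)]
  have r4 := runs_distribute (A := A) (k := k) (ℓ := ℓ) (2 * (k + ℓ) + 5 + n)
    (by rw [mem_paramCols]; omega) X s2 (by simp [hs2])
  set s3 : Store U := fun y => if y = 2 * (k + ℓ) + 5 + n then [] else if y ∈ paramCols k ℓ then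
      X.reverse.map .elt ++ s2 y else s2 y with hs3
  have hs3' : ∀ y, y < 2 * (k + ℓ) + 5 → y ∉ paramCols k ℓ → s3 y = s1 y := by
    intro y hy hy'
    have h : y ≠ 2 * (k + ℓ) + 5 + n := by omega
    rw [← hs2' y hy]
    simp [hs3, h, hy']
  refine ⟨s3, X.reverse, (h0.seq (r1.seq r4)).mono ?_, ?_, ⟨fun i => ?_, ?_, ?_, ?_, ?_⟩,
    fun j => ⟨?_, ?_⟩, ?_, ?_⟩
  · rw [h6] at r3 ⊢
    have := Nat.mul_le_mul_right (ℓ + 4) r3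
    simp only [prepareSteps]
    omega
  · rw [hs3' 0 (by omega) (by rw [mem_paramCols]; omega), h1]
  · rw [hs3' _ (by omega) (by rw [mem_paramCols]; omega), h2]
    simp
  · rw [hs3' _ (by omega) (by rw [mem_paramCols]; omega), h3]
    simp
  · rw [hs3' _ (by omega) (by rw [mem_paramCols]; omega),
      h7' _ (by omega) (by rw [mem_exampleCols]; omega) (by omega)]
  · rw [hs3' _ (by omega) (by rw [mem_paramCols]; omega),
      h7' _ (by omega) (by rw [mem_exampleCols]; omega) (by omega)]
  · intro y hy
    by_cases hy1 : y = 2 * (k + ℓ) + 5 + n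
    · simp [hs3, hy1]
    · have hy2 : y ∉ paramCols k ℓ := by rw [mem_paramCols]; omega
      simp only [hs3, hy1, hy2, if_false, hs2, Function.update_of_ne hy1]
      by_cases hy3 : y = 2 * (k + ℓ) + 5
      · simp [hy3]
      · rw [Function.update_of_ne hy3]
        exact h7' y (by omega) (by rw [mem_exampleCols]; omega) hy3
  · have hj : 1 + k + j.val ∈ paramCols k ℓ := by rw [mem_paramCols]; omega
    have hj' : 1 + k + j.val ≠ 2 * (k + ℓ) + 5 + n := by omega
    simp only [hs3, hj, hj', if_false, if_true]
    rw [hs2' _ (by omega), h7' _ (by omega) (by rw [mem_exampleCols]; omega) (by omega),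
      List.append_nil]
  · rw [hs3' _ (by omega) (by rw [mem_paramCols]; omega),
      h7' _ (by omega) (by rw [mem_exampleCols]; omega) (by omega)]
  · intro e he i z hz
    simpa using r2 _ (h5 e he i) z hz
  · rw [List.length_reverse, ← h6]
    exact r3

/-- Try all hypotheses that are given by the formulas in a list. -/
def searchAll (bits : Guarded L (k + ℓ) → List Bool) : List (Guarded L (k + ℓ)) → Program L
  | [] => .skip
  | ψ :: l => .seq (overParams k ℓ (List.finRange ℓ) (tryOut bits ψ)) (searchAll bits l)

def searchSteps (bits : Guarded L (k + ℓ) → List Bool) (n d t : ℕ) :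
    List (Guarded L (k + ℓ)) → ℕ
  | [] => 2
  | ψ :: l => overParamsSteps n (tryOutSteps bits ψ d t) ℓ + searchSteps bits n d t l

/-- `Loaded` does not mention the output, the parameter stacks or their auxiliary stacks, so it
survives inside the parameter loops. -/
lemma Loaded.congr {T : List ((Fin k → U) × Bool)} {s s' : Store U} (hs : Loaded k ℓ T s)
    (h : ∀ y, y ≠ 0 → (∀ j : Fin ℓ, y ≠ 1 + k + j ∧ y ≠ 1 + k + j + (k + ℓ + 2)) → s' y = s y) :
    Loaded k ℓ T s' where
  component i := by rw [h _ (by omega) (fun j => by omega), hs.component]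
  label := by rw [h _ (by omega) (fun j => by omega), hs.label]
  label_aux := by rw [h _ (by omega) (fun j => by omega), hs.label_aux]
  flag := by rw [h _ (by omega) (fun j => by omega), hs.flag]
  fresh y hy := by rw [h _ (by omega) (fun j => by omega), hs.fresh y hy]

lemma runs_searchAll [Finite U] {d : ℕ} (hd : maxDegree L U ≤ d)
    (bits : Guarded L (k + ℓ) → List Bool) (l : List (Guarded L (k + ℓ)))
    {T : List ((Fin k → U) × Bool)} {s : Store U} (hs : Loaded k ℓ T s) (X : List U)
    (hX : ∀ j : Fin ℓ, s (1 + k + j) = X.map .elt ∧ s (1 + k + j + (k + ℓ + 2)) = []) :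
    ∃ o, Found (Fits T) (fitCells bits) {h | h.1 ∈ l ∧ ∀ j, h.2 j ∈ X} (s 0) o ∧
      Runs A (searchAll bits l) s (Function.update s 0 o)
        (searchSteps bits X.length d T.length l) := by
  induction l generalizing s with
  | nil =>
    refine ⟨s 0, ?_, ?_⟩
    · convert Found.empty (s 0) using 1
      simp
    · rw [Function.update_eq_self]
      exact Runs.skip s
  | cons ψ l ih =>
    obtain ⟨o, ho, h⟩ := runs_overParams (A := A) (good := Fits T) (out := fitCells bits)
      (fun h => by simp [fitCells]) (fun ws => (ψ, ws)) s X
      (fun s' hs' ws hws => runs_tryOut (A := A) hd bits ψ (hs.congr hs') ws hws)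
      (List.finRange ℓ) (List.nodup_finRange ℓ) s (fun _ _ _ => rfl)
      (fun j hj => absurd (List.mem_finRange j) hj) (fun j _ => hX j)
    obtain ⟨o', ho', h'⟩ := ih (s := Function.update s 0 o)
      (hs.congr fun y hy _ => by simp [hy])
      (fun j => by
        rw [Function.update_of_ne (by omega), Function.update_of_ne (by omega)]
        exact hX j)
    rw [Function.update_self, Function.update_idem] at *
    refine ⟨o', ?_, ?_⟩
    · convert ho.union (fun h => by simp [fitCells]) ho' using 1
      ext ⟨φ, ws⟩
      simp only [Set.mem_ofPred_eq, List.mem_cons, Set.mem_union, Set.mem_image, List.mem_finRange,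
        not_true_eq_false, IsEmpty.forall_iff, implies_true, true_and, forall_const, Prod.mk.injEq]
      constructor
      · rintro ⟨rfl | h1, h2⟩
        · exact Or.inl ⟨ws, h2, rfl, rfl⟩
        · exact Or.inr ⟨h1, h2⟩
      · rintro (⟨ws', h1, rfl, rfl⟩ | ⟨h1, h2⟩)
        · exact ⟨Or.inl rfl, h1⟩
        · exact ⟨Or.inr h1, h2⟩
    · have h2 := h.seq h'
      rwa [List.length_finRange] at h2

/-- The learner, with parameters at distance at most `n` from the examples. -/
def learner (bits : Guarded L (k + ℓ) → List Bool) (n : ℕ) (l : List (Guarded L (k + ℓ))) :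
    Program L :=
  .seq (prepare k ℓ n) (.seq (searchAll bits l)
    (.ite (.nonempty 0) .skip (.basic (.push 0 false))))

/-- Rejection only excludes parameters within distance `n` of the examples. A positive output is
sound in any case, having been checked against all of `T`. -/
theorem runs_learner [Finite U] {d : ℕ} (hd : maxDegree L U ≤ d)
    (bits : Guarded L (k + ℓ) → List Bool) (n : ℕ) (l : List (Guarded L (k + ℓ)))
    (T : List ((Fin k → U) × Bool)) :
    ∃ (s : Store U) (m : ℕ), m ≤ T.length * k * (d + 1) ^ n ∧
      Runs A (learner bits n l) (Function.update (fun _ => []) 0 (trainingCells T)) s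
        (prepareSteps k ℓ n d T.length + (searchSteps bits m d T.length l + 3)) ∧
      ((s 0 = [.bit false] ∧ ∀ h : Guarded L (k + ℓ) × (Fin ℓ → U), h.1 ∈ l →
          (∀ j, ∃ e ∈ T, ∃ i, Near (gaifmanGraph L U) n (e.1 i) (h.2 j)) → ¬ Fits T h) ∨
        ∃ h, h.1 ∈ l ∧ Fits T h ∧ s 0 = fitCells bits h) := by
  obtain ⟨s, X, h1, h2, h3, h4, h5, h6⟩ := runs_prepare (A := A) (ℓ := ℓ) hd n T
  obtain ⟨o, ho, r⟩ := runs_searchAll (A := A) hd bits l h3 X h4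
  rw [List.length_reverse] at r
  have hfit : ∀ h : Guarded L (k + ℓ) × (Fin ℓ → U), Fits T.reverse h ↔ Fits T h := by
    intro h
    simp [Fits]
  rcases ho with ⟨h, -⟩ | ⟨-, rfl, h⟩ | ⟨-, h, hmem, hgood, rfl⟩
  · exact absurd h2 h
  · refine ⟨_, X.length, h6, h1.seq (r.seq ((Runs.ite_neg ?_
      (Runs.basic (.push 0 false) _)).mono (by omega))), Or.inl ⟨?_, ?_⟩⟩
    · simp [Test.Holds]
    · simp [Instr.apply]
    · intro g hg hnear hgood
      refine h g ⟨hg, fun j => ?_⟩ ((hfit g).2 hgood)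
      obtain ⟨e, he, i, hi⟩ := hnear j
      exact h5 e he i _ hi
  · refine ⟨_, X.length, h6, h1.seq (r.seq (Runs.ite_pos ?_ (Runs.skip _))),
      Or.inr ⟨h, hmem.1, (hfit h).1 hgood, ?_⟩⟩
    · simp [Test.Holds, fitCells]
    · simp

end Preparation

/-! ## The evaluator -/

section Evaluator

variable {L : FirstOrder.Language.{u, v}} {U : Type w} [L.Structure U] {A : LocalAccess L U}
  {k ℓ : ℕ}

/-- Read at most `n` bits from stack `0` and act according to what has been read. -/
def readBits (act : List Bool → Program L) : ℕ → List Bool → Program L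
  | 0, w => act w
  | n + 1, w => .ite (.isBit 0 true) (.seq (.basic (.pop 0)) (readBits act n (w ++ [true])))
      (.ite (.isBit 0 false) (.seq (.basic (.pop 0)) (readBits act n (w ++ [false]))) (act w))

/-- The code ends at the first cell that is not a bit, or with the stack. The arguments are
elements, so the coding need not be prefix-free. -/
lemma runs_readBits [Finite U] (act : List Bool → Program L) (n B : ℕ) (bits w : List Bool)
    (hn : bits.length ≤ n) (rest : List (Cell U)) (hrest : ∀ b, rest.head? ≠ some (.bit b))
    (s s' : Store U) (hs : s 0 = bits.map .bit ++ rest)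
    (h : Runs A (act (w ++ bits)) (Function.update s 0 rest) s' B) :
    Runs A (readBits act n w) s s' (3 * n + B) := by
  induction n generalizing bits w s with
  | zero =>
    obtain rfl : bits = [] := List.length_eq_zero_iff.1 (by omega)
    rw [List.map_nil, List.nil_append] at hs
    rw [← hs, Function.update_eq_self, List.append_nil] at h
    exact h.mono (by omega)
  | succ n ih =>
    cases bits with
    | nil =>
      rw [List.map_nil, List.nil_append] at hs
      rw [← hs, Function.update_eq_self, List.append_nil] at h
      refine (Runs.ite_neg ?_ (Runs.ite_neg ?_ h)).mono (by omega)
      · simpa [Test.Holds, hs] using hrest true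
      · simpa [Test.Holds, hs] using hrest false
    | cons b bits =>
      have hpop : Runs A (.basic (.pop 0)) s
          (Function.update s 0 (bits.map .bit ++ rest)) 1 := by
        simpa [Instr.apply, hs] using Runs.basic (A := A) (.pop 0) s
      have h' := ih bits (w ++ [b]) (by simpa using hn)
        (Function.update s 0 (bits.map .bit ++ rest)) (by simp) (by simpa using h)
      cases b with
      | true =>
        exact (Runs.ite_pos (by simp [Test.Holds, hs]) (hpop.seq h')).mono (by omega)
      | false =>
        exact (Runs.ite_neg (by simp [Test.Holds, hs]) (Runs.ite_pos (by simp [Test.Holds, hs])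
          (hpop.seq h'))).mono (by omega)

/-- Read the arguments from stack `0` and evaluate a formula. -/
def evalArgs (ψ : Guarded L (k + ℓ)) : Program L :=
  -- The input lists the parameters before the instance.
  .seq (.instrs (deal (paramCols k ℓ ++ (List.finRange k).map fun i => 1 + i.val)))
    (ψ.program (fun i => 1 + i) (k + ℓ + 1) 0)

open Classical in
lemma runs_evalArgs [Finite U] {d : ℕ} (hd : maxDegree L U ≤ d) (ψ : Guarded L (k + ℓ))
    (us : Fin k → U) (vs : Fin ℓ → U) (s : Store U) (hs : s 0 = tupleCells vs ++ tupleCells us)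
    (hs' : ∀ y ≠ 0, s y = []) :
    ∃ s', s' 0 = [.bit (decide (ψ.Realize (Fin.append us vs)))] ∧
      Runs A (evalArgs ψ) s s' (2 * (k + ℓ) + 2 + ψ.steps d) := by
  let l : List (ℕ × Cell U) := (List.finRange ℓ).map (fun j => (1 + k + j.val, .elt (vs j))) ++
    (List.finRange k).map (fun i => (1 + i.val, .elt (us i)))
  have hfst : l.map Prod.fst = paramCols k ℓ ++ (List.finRange k).map fun i => 1 + i.val := by
    simp [l, paramCols, Function.comp_def]
  have hmem : ∀ y, y ∈ (List.finRange k).map (fun i => 1 + i.val) → 1 ≤ y ∧ y ≤ k := by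
    intro y hy
    simp only [List.mem_map, List.mem_finRange, true_and] at hy
    obtain ⟨i, rfl⟩ := hy
    omega
  have hnd : (l.map Prod.fst).Nodup := by
    rw [hfst]
    refine List.Nodup.append (nodup_paramCols k ℓ)
      ((List.nodup_finRange k).map fun i j h => Fin.ext (by simpa using h)) ?_
    intro y hy hy'
    rw [mem_paramCols] at hy
    have := hmem y hy'
    omega
  have hlarge : ∀ y, y = 0 ∨ k + ℓ + 1 ≤ y → y ∉ l.map Prod.fst := by
    intro y hy h
    rw [hfst, List.mem_append, mem_paramCols] at h
    rcases h with h | h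
    · omega
    · have := hmem y h
      omega
  obtain ⟨h1, h2, h3⟩ := Instr.run_deal (A := A) l hnd (hlarge 0 (Or.inl rfl)) [] s
    (by rw [hs]; simp [l, tupleCells_eq_map, Function.comp_def])
  have h := Runs.instrs (A := A) (deal (l.map Prod.fst)) s
  change Runs A _ _ (Instr.run A _ _) _ at h
  have h4 := ψ.runs_program (A := A) hd (fun i => 1 + i) (k + ℓ + 1) 0
    (Instr.run A (deal (l.map Prod.fst)) s) (Fin.append us vs)
    (by
      intro i
      refine Fin.addCases (fun i => ?_) (fun j => ?_) i
      · have := h2 (1 + i.val, .elt (us i))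
          (List.mem_append_right _ (List.mem_map.2 ⟨i, List.mem_finRange i, rfl⟩))
        simp [this]
      · have := h2 (1 + k + j.val, .elt (vs j))
          (List.mem_append_left _ (List.mem_map.2 ⟨j, List.mem_finRange j, rfl⟩))
        simp [← add_assoc, this])
    (fun i => by omega) (fun i => by omega) (by omega)
    (fun y hy => by rw [h3 y (by omega) (hlarge y (Or.inr hy)), hs' y (by omega)])
  rw [h1] at h4
  rw [hfst] at h h4
  have h5 := h.seq h4
  refine ⟨_, ?_, h5.mono ?_⟩
  · exact Function.update_self 0 _ (Instr.run A _ s)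
  · simp only [length_deal, List.length_append, List.length_map, paramCols, List.length_finRange]
    omega

open Classical in
/-- The evaluator, for hypotheses that are given by the formulas in a list. -/
noncomputable def evaluator (bits : Guarded L (k + ℓ) → List Bool)
    (l : List (Guarded L (k + ℓ))) : Program L :=
  readBits (fun w => if h : ∃ ψ ∈ l, bits ψ = w then evalArgs h.choose else .skip)
    (l.map fun ψ => (bits ψ).length).sum []

-- The evaluator picks some listed formula with the bits it has read, not necessarily `ψ`; `hbits`
-- makes the choice irrelevant.
open Classical in
theorem runs_evaluator [Finite U] {d : ℕ} (hd : maxDegree L U ≤ d)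
    (bits : Guarded L (k + ℓ) → List Bool) (l : List (Guarded L (k + ℓ))) {ψ : Guarded L (k + ℓ)}
    (hψ : ψ ∈ l) (us : Fin k → U) (vs : Fin ℓ → U)
    (hbits : ∀ ψ' ∈ l, bits ψ' = bits ψ →
      (ψ'.Realize (Fin.append us vs) ↔ ψ.Realize (Fin.append us vs))) :
    ∃ s, s 0 = [.bit (decide (ψ.Realize (Fin.append us vs)))] ∧
      Runs A (evaluator bits l) (Function.update (fun _ => []) 0
        ((bits ψ).map .bit ++ (tupleCells vs ++ tupleCells us))) s
        (3 * (l.map fun ψ => (bits ψ).length).sum +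
          (2 * (k + ℓ) + 2 + (l.map fun ψ => ψ.steps d).sum)) := by
  have hex : ∃ ψ' ∈ l, bits ψ' = bits ψ := ⟨ψ, hψ, rfl⟩
  obtain ⟨s, hs, h⟩ := runs_evalArgs (A := A) hd hex.choose us vs
    (Function.update (fun _ => []) 0 (tupleCells vs ++ tupleCells us)) (by simp)
    (fun y hy => by simp [hy])
  have hle : hex.choose.steps d ≤ (l.map fun ψ => ψ.steps d).sum :=
    List.single_le_sum (by simp) _ (List.mem_map_of_mem hex.choose_spec.1)
  refine ⟨s, ?_, runs_readBits _ _ _ (bits ψ) [] ?_ (tupleCells vs ++ tupleCells us) ?_ _ s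
    (by simp) ?_⟩
  · rw [hs]
    congr 2
    exact decide_eq_decide.2 (hbits _ hex.choose_spec.1 hex.choose_spec.2)
  · exact List.single_le_sum (by simp) _ (List.mem_map_of_mem hψ)
  · intro b h
    have : Cell.bit b ∈ tupleCells vs ++ tupleCells us := List.mem_of_mem_head? h
    simp [tupleCells] at this
  · rw [List.nil_append, dif_pos hex, Function.update_idem]
    exact h.mono (by omega)

end Evaluator

/-! ## Polynomial bounds -/

/-- `g` is bounded by a polynomial. -/
def PolyBounded (g : ℕ → ℕ) : Prop := ∃ C c, ∀ N, 1 ≤ N → g N ≤ C * N ^ c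

namespace PolyBounded

lemma const (a : ℕ) : PolyBounded fun _ => a := ⟨a, 0, fun N _ => by simp⟩

lemma id : PolyBounded fun N => N := ⟨1, 1, fun N _ => by simp⟩

lemma add {f g : ℕ → ℕ} (hf : PolyBounded f) (hg : PolyBounded g) :
    PolyBounded fun N => f N + g N := by
  obtain ⟨C, c, h⟩ := hf
  obtain ⟨C', c', h'⟩ := hg
  refine ⟨C + C', c + c', fun N hN => ?_⟩
  have h1 : N ^ c ≤ N ^ (c + c') := Nat.pow_le_pow_right hN (by omega)
  have h2 : N ^ c' ≤ N ^ (c + c') := Nat.pow_le_pow_right hN (by omega)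
  calc f N + g N ≤ C * N ^ c + C' * N ^ c' := add_le_add (h N hN) (h' N hN)
    _ ≤ C * N ^ (c + c') + C' * N ^ (c + c') := by gcongr
    _ = _ := by ring

lemma mul {f g : ℕ → ℕ} (hf : PolyBounded f) (hg : PolyBounded g) :
    PolyBounded fun N => f N * g N := by
  obtain ⟨C, c, h⟩ := hf
  obtain ⟨C', c', h'⟩ := hg
  refine ⟨C * C', c + c', fun N hN => ?_⟩
  calc f N * g N ≤ (C * N ^ c) * (C' * N ^ c') := Nat.mul_le_mul (h N hN) (h' N hN)
    _ = _ := by ring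

lemma pow {f : ℕ → ℕ} (hf : PolyBounded f) (n : ℕ) : PolyBounded fun N => f N ^ n := by
  induction n with
  | zero => simpa using const 1
  | succ n ih => simpa only [pow_succ] using ih.mul hf

lemma sum {α : Type*} (l : List α) {f : α → ℕ → ℕ} (hf : ∀ a, PolyBounded (f a)) :
    PolyBounded fun N => (l.map fun a => f a N).sum := by
  induction l with
  | nil => simpa using const 0
  | cons a l ih => simpa using (hf a).add ih

end PolyBounded

section Bounds

variable {L : FirstOrder.Language.{u, v}} {k ℓ : ℕ}

lemma Guarded.polyBounded_steps {m : ℕ} (φ : Guarded L m) : PolyBounded φ.steps := by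
  induction φ with
  | falsum => exact .const 1
  | eq => exact .const 2
  | rel => exact .const 2
  | imp φ ψ ihφ ihψ => exact (ihφ.add ihψ).add (.const 4)
  | ex i φ ih => exact (PolyBounded.const 3).add (PolyBounded.id.mul (ih.add (.const 4)))

/-- Monotonicity lets the actual numbers of parameter values and examples be replaced by bounds in a
single variable. -/
lemma overParamsSteps_mono {n n' B B' : ℕ} (hn : n ≤ n') (hB : B ≤ B') (m : ℕ) :
    overParamsSteps n B m ≤ overParamsSteps n' B' m := by
  induction m with
  | zero => exact hB
  | succ m ih =>
    simp only [overParamsSteps]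
    gcongr

lemma polyBounded_overParamsSteps {n B : ℕ → ℕ} (hn : PolyBounded n) (hB : PolyBounded B) (m : ℕ) :
    PolyBounded fun N => overParamsSteps (n N) (B N) m := by
  induction m with
  | zero => exact hB
  | succ m ih => exact (hn.mul (ih.add (.const 10))).add (.const 2)

lemma searchSteps_mono (bits : Guarded L (k + ℓ) → List Bool) {n n' t t' : ℕ} (d : ℕ) (hn : n ≤ n')
    (ht : t ≤ t') (l : List (Guarded L (k + ℓ))) :
    searchSteps bits n d t l ≤ searchSteps bits n' d t' l := by
  induction l with
  | nil => exact le_rfl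
  | cons ψ l ih =>
    refine add_le_add (overParamsSteps_mono hn ?_ ℓ) ih
    simp only [tryOutSteps]
    gcongr

lemma polyBounded_searchSteps (bits : Guarded L (k + ℓ) → List Bool) {n : ℕ → ℕ}
    (hn : PolyBounded n) (l : List (Guarded L (k + ℓ))) :
    PolyBounded fun N => searchSteps bits (n N) N N l := by
  induction l with
  | nil => exact .const 2
  | cons ψ l ih =>
    refine (polyBounded_overParamsSteps hn ?_ ℓ).add ih
    exact (PolyBounded.id.mul ((ψ.polyBounded_steps.add (.const _)).add (.const 15))).add (.const _)

lemma expandSteps_mono {x x' : ℕ} (d : ℕ) (hx : x ≤ x') (n : ℕ) :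
    expandSteps x d n ≤ expandSteps x' d n := by
  induction n with
  | zero => exact le_rfl
  | succ n ih =>
    simp only [expandSteps]
    gcongr

lemma prepareSteps_mono (k ℓ n d : ℕ) {t t' : ℕ} (ht : t ≤ t') :
    prepareSteps k ℓ n d t ≤ prepareSteps k ℓ n d t' := by
  have := expandSteps_mono d (Nat.mul_le_mul_right k ht) n
  simp only [prepareSteps]
  gcongr

lemma polyBounded_expandSteps (k n : ℕ) : PolyBounded fun N => expandSteps (N * k) N n := by
  induction n with
  | zero => exact .const 2
  | succ n ih =>
    exact ih.add ((PolyBounded.const 1).add (((PolyBounded.id.mul (.const k)).mul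
      ((PolyBounded.id.add (.const 1)).pow n)).mul (.const 6)))

lemma polyBounded_prepareSteps (k ℓ n : ℕ) : PolyBounded fun N => prepareSteps k ℓ n N N :=
  ((PolyBounded.const 1).add (PolyBounded.id.mul (.const _))).add
    ((polyBounded_expandSteps k n).add ((PolyBounded.const 1).add
      (((PolyBounded.id.mul (.const k)).mul ((PolyBounded.id.add (.const 1)).pow n)).mul
        (.const _))))

lemma unitCost_le {U : Type w} [L.Structure U] {N : ℕ}
    (hN : Nat.log 2 (Nat.card U) + maxDegree L U + 1 ≤ N) : unitCost L U ≤ 1 + 2 * N + N * N := by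
  have h1 : eltSize U ≤ N := by unfold eltSize; omega
  have h2 : maxDegree L U ≤ N := by omega
  unfold unitCost
  gcongr

/-- Programs that run in polynomially many steps compute in polynomial time. -/
lemma Runs.computesWithin {U : Type w} [L.Structure U] {A : LocalAccess L U} {p : Program L}
    {input : List (Cell U)} {s : Store U} {n N C c : ℕ} {g : ℕ → ℕ}
    (hg : ∀ N, 1 ≤ N → g N * (1 + 2 * N + N * N) ≤ C * N ^ c)
    (hN : Nat.log 2 (Nat.card U) + maxDegree L U + 1 ≤ N) (hn : n ≤ g N)
    (h : Runs A p (Function.update (fun _ => []) 0 input) s n) :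
    p.ComputesWithin A input (s 0) (C * N ^ c) := by
  obtain ⟨m, hm, hle⟩ := h
  exact ⟨s, m, hm, rfl, hle.trans ((Nat.mul_le_mul hn (unitCost_le hN)).trans (hg N (by omega)))⟩

lemma PolyBounded.mul_unitCost {g : ℕ → ℕ} (hg : PolyBounded g) :
    PolyBounded fun N => g N * (1 + 2 * N + N * N) :=
  hg.mul (((PolyBounded.const 1).add ((PolyBounded.const 2).mul .id)).add (PolyBounded.id.mul .id))

end Bounds

lemma fits_iff_consistent {L : FirstOrder.Language.{u, v}} [Finite (Σ m, L.Relations m)]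
    {U : Type w} [L.Structure U] {k ℓ : ℕ} (T : List ((Fin k → U) × Bool))
    (h : Guarded L (k + ℓ) × (Fin ℓ → U)) :
    Fits T h ↔ Consistent (hypothesis (Guarded.toFormula.{u, v, w} h.1) h.2) T := by
  refine forall₂_congr fun e _ => ?_
  rw [hypothesis, ← Guarded.realize_toFormula.{u, v, w}]
  cases e.2 <;> simp

theorem theorem1
    (L : FirstOrder.Language.{u, v}) [L.IsRelational] [Finite (Σ m, L.Relations m)]
    (k ℓ q : ℕ) :
    ∃ qStar : ℕ,
      -- formulas are given to and returned by programs as bit strings, in an arbitrary coding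
      ∀ code : L.Formula (Fin k ⊕ Fin ℓ) → List Bool, Function.Injective code →
        ∃ (learner evaluator : Program L) (C c : ℕ),
          ∀ (U : Type w) [Finite U] [L.Structure U] (A : LocalAccess L U)
            (T : List ((Fin k → U) × Bool)),
            ∃ outcome : Option (L.Formula (Fin k ⊕ Fin ℓ) × (Fin ℓ → U)),
              -- the learner halts in time polynomial in `log n + d + t`
              learner.ComputesWithin A (trainingCells T) (outcomeCells code outcome)
                (C * (Nat.log 2 (Nat.card U) + maxDegree L U + T.length + 1) ^ c) ∧
              -- a returned hypothesis has bounded quantifier rank and is consistent, ...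
              (∀ φ vs, outcome = some (φ, vs) →
                quantifierRank φ ≤ qStar ∧ Consistent (hypothesis φ vs) T ∧
                -- ... and it can be evaluated in time polynomial in `log n + d`
                ∀ us : Fin k → U,
                  evaluator.ComputesWithin A (hypothesisCells code (φ, vs) ++ tupleCells us)
                    [Cell.bit (hypothesis φ vs us)]
                    (C * (Nat.log 2 (Nat.card U) + maxDegree L U + 1) ^ c)) ∧
              -- the learner does not reject if there is a consistent hypothesis of rank `q`; if
              -- there are parameter variables, some element must occur in the training sequence
              ((0 < ℓ → 0 < k ∧ T ≠ []) →
                (∃ (φ : L.Formula (Fin k ⊕ Fin ℓ)) (vs : Fin ℓ → U),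
                  quantifierRank φ ≤ q ∧ Consistent (hypothesis φ vs) T) →
                outcome ≠ none) := by
  classical
  set Q := localRank q (k + ℓ)
  set l := Guarded.candidates L Q (k + ℓ)
  -- The sum bounds the rank of every formula in the list, and it is fixed before the coding is
  -- given.
  refine ⟨(l.map fun ψ => quantifierRank (Guarded.toFormula.{u, v, w} ψ)).sum,
    fun code hcode => ?_⟩
  set bits : Guarded L (k + ℓ) → List Bool := fun ψ => code (Guarded.toFormula.{u, v, w} ψ)
  set n := ℓ * (Q + 1)
  -- Steps of the learner when both d and t are at most N; N * k * (N + 1) ^ n then bounds the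
  -- number of values per parameter.
  let g : ℕ → ℕ := fun N =>
    prepareSteps k ℓ n N N + (searchSteps bits (N * k * (N + 1) ^ n) N N l + 3)
  let g' : ℕ → ℕ := fun N => 3 * (l.map fun ψ => (bits ψ).length).sum +
    (2 * (k + ℓ) + 2 + (l.map fun ψ => ψ.steps N).sum)
  have hg : PolyBounded g := (polyBounded_prepareSteps k ℓ n).add
    ((polyBounded_searchSteps bits ((PolyBounded.id.mul (.const k)).mul
      ((PolyBounded.id.add (.const 1)).pow n)) l).add (.const 3))
  have hg' : PolyBounded g' := (PolyBounded.const _).add ((PolyBounded.const _).add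
    (.sum l fun ψ => ψ.polyBounded_steps))
  -- Bounding the sum gives one pair of constants for both programs.
  obtain ⟨C, c, hC⟩ := (hg.add hg').mul_unitCost
  refine ⟨learner bits n l, evaluator bits l, C, c, fun U _ _ A T => ?_⟩
  set N := Nat.log 2 (Nat.card U) + maxDegree L U + T.length + 1 with hN
  obtain ⟨s, m, hm, hrun, hres⟩ := runs_learner (A := A) (d := N) (by omega) bits n l T
  have hm' : m ≤ N * k * (N + 1) ^ n := hm.trans (by gcongr; omega)
  have hcomp : (learner bits n l).ComputesWithin A (trainingCells T) (s 0) (C * N ^ c) := by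
    refine hrun.computesWithin hC (by omega) ?_
    refine le_trans ?_ (Nat.le_add_right _ _)
    exact add_le_add (prepareSteps_mono k ℓ n N (by omega))
      (Nat.add_le_add_right (searchSteps_mono bits N hm' (by omega) l) 3)
  rcases hres with ⟨hs, hno⟩ | ⟨⟨ψ, ws⟩, hψ, hfit, hs⟩
  · rw [hs] at hcomp
    refine ⟨none, hcomp, by simp, ?_⟩
    rintro hT ⟨φ, vs, hφ, hcons⟩
    obtain ⟨ψ, hψ, ws, hnear, hfit⟩ := exists_consistent_candidate hT hφ hcons
    exact absurd hfit (hno (ψ, ws) hψ hnear)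
  · refine ⟨some (Guarded.toFormula.{u, v, w} ψ, ws), ?_, ?_, by simp⟩
    · rw [hs] at hcomp
      exact hcomp
    · rintro φ vs heq
      simp only [Option.some.injEq, Prod.mk.injEq] at heq
      obtain ⟨rfl, rfl⟩ := heq
      refine ⟨List.single_le_sum (by simp) _ (List.mem_map_of_mem hψ),
        (fits_iff_consistent T (ψ, ws)).1 hfit, fun us => ?_⟩
      -- The bound on the degree used here must not involve the length of `T`.
      obtain ⟨s', hs', hrun'⟩ := runs_evaluator (A := A)
        (d := Nat.log 2 (Nat.card U) + maxDegree L U + 1) (by omega) bits l hψ us ws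
        -- Different guarded formulas may share a code, but by injectivity they then have the same
        -- first-order translation.
        (fun ψ' _ h => by
          rw [← Guarded.realize_toFormula.{u, v, w}, ← Guarded.realize_toFormula.{u, v, w},
            hcode h])
      have hcomp' := hrun'.computesWithin hC le_rfl (Nat.le_add_left _ _)
      rw [hs', ← List.append_assoc] at hcomp'
      have hyp : hypothesis (Guarded.toFormula.{u, v, w} ψ) ws us =
          decide (ψ.Realize (Fin.append us ws)) :=
        decide_eq_decide.2 (Guarded.realize_toFormula.{u, v, w} ψ us ws)
      rw [hyp]
      exact hcomp'
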